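/- Write $[\omega]^{\omega}$ for the set of infinite subsets of $\omega$. A family $\mathcal{A}\subseteq[\omega]^{\omega}$ is almost disjoint (AD) if any two different elements of $\mathcal{A}$ have finite intersection; a MAD family is an infinite AD family that is maximal, with respect to inclusion, among AD families. The almost disjointness number $\mathfrak{a}$ is the smallest size of a MAD family. A set $S$ splits $X$ if $S\cap X$ and $X\setminus S$ are both infinite, and the splitting number $\mathfrak{s}$ is the smallest size of a family $\mathcal{S}\subseteq[\omega]^{\omega}$ such that every $X\in[\omega]^{\omega}$ is split by some $S\in\mathcal{S}$. An ideal on $\omega$ is a nonempty family of subsets of $\omega$ closed under subsets and finite unions; an ideal $\mathcal{I}$ is tall if for every $X\in[\omega]^{\omega}$ there is $Y\in\mathcal{I}$ such that $X\cap Y$ is infinite. For an AD family $\mathcal{A}$, let $\mathcal{I}(\mathcal{A})$ be the ideal generated by $\mathcal{A}$ and the finite subsets of $\omega$, and let $\mathcal{I}(\mathcal{A})^{+}=\wp(\omega)\setminus\mathcal{I}(\mathcal{A})$. A tree is a nonempty set $T\subseteq\omega^{<\omega}$ closed under initial segments; it is $\mathcal{I}(\mathcal{A})^{+}$-branching if $\{n\in\omega\mid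 s^{\frown}\langle n\rangle\in T\}\in\mathcal{I}(\mathcal{A})^{+}$ for every $s\in T$, and $[T]$ is the set of all $f\in\omega^{\omega}$ with $f\upharpoonright n\in T$ for all $n\in\omega$. An AD family $\mathcal{A}$ is $+$-Ramsey if for every $\mathcal{I}(\mathcal{A})^{+}$-branching tree $T$ there is $f\in[T]$ such that $\mathrm{im}(f)\in\mathcal{I}(\mathcal{A})^{+}$. Corollary 25. Assume $\mathfrak{s}\leq\mathfrak{a}$. If $\mathcal{I}$ is a tall ideal on $\omega$, then there is a $+$-Ramsey MAD family $\mathcal{A}$ such that $\mathcal{A}\subseteq\mathcal{I}$. -/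

import Mathlib

namespace PlusRamsey

/-- A family of infinite subsets of `ω` any two different members of which have finite
intersection. -/
def IsAD (A : Set (Set ℕ)) : Prop :=
  (∀ X ∈ A, X.Infinite) ∧ A.Pairwise fun X Y => (X ∩ Y).Finite

/-- A MAD family: an infinite almost disjoint family, maximal under inclusion among all
almost disjoint families. (Finite maximal families such as `{ω}` are excluded, as usual.) -/
def IsMAD (A : Set (Set ℕ)) : Prop :=
  A.Infinite ∧ Maximal IsAD A

/-- `S` splits `X`. -/
def Splits (S X : Set ℕ) : Prop :=
  (S ∩ X).Infinite ∧ (X \ S).Infinite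

/-- A family of infinite sets such that every infinite set is split by one of its members. -/
def IsSplittingFamily (𝒮 : Set (Set ℕ)) : Prop :=
  (∀ S ∈ 𝒮, S.Infinite) ∧ ∀ X : Set ℕ, X.Infinite → ∃ S ∈ 𝒮, Splits S X

/-- The splitting number `𝔰`. -/
noncomputable def splittingNumber : Cardinal.{0} :=
  sInf {κ | ∃ 𝒮 : Set (Set ℕ), IsSplittingFamily 𝒮 ∧ Cardinal.mk 𝒮 = κ}

/-- The almost disjointness number `𝔞`: the smallest size of an (infinite) MAD family. -/
noncomputable def almostDisjointnessNumber : Cardinal.{0} :=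
  sInf {κ | ∃ A : Set (Set ℕ), IsMAD A ∧ Cardinal.mk A = κ}

/-- The ideal `𝓘(A)` on `ω` generated by `A` (together with the finite sets): the sets that are
covered, up to finitely many points, by finitely many members of `A`. -/
def generatedIdeal (A : Set (Set ℕ)) : Order.Ideal (Set ℕ) where
  carrier := {X | ∃ F : Set (Set ℕ), F.Finite ∧ F ⊆ A ∧ (X \ ⋃₀ F).Finite}
  lower' := by
    rintro X Y hYX ⟨F, hF, hFA, h⟩
    exact ⟨F, hF, hFA, h.subset (Set.sdiff_subset_sdiff_left hYX)⟩
  nonempty' := ⟨∅, ∅, by simp⟩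
  directed' := by
    rintro X ⟨F, hF, hFA, hX⟩ Y ⟨G, hG, hGA, hY⟩
    refine ⟨X ∪ Y, ⟨F ∪ G, hF.union hG, Set.union_subset hFA hGA, ?_⟩,
      Set.subset_union_left, Set.subset_union_right⟩
    refine (hX.union hY).subset ?_
    rintro x ⟨hx | hx, hn⟩
    · exact Or.inl ⟨hx, fun h => hn (Set.sUnion_mono Set.subset_union_left h)⟩
    · exact Or.inr ⟨hx, fun h => hn (Set.sUnion_mono Set.subset_union_right h)⟩

/-- `generatedIdeal A` is the least ideal containing `A` and all finite sets. -/
theorem isLeast_generatedIdeal (A : Set (Set ℕ)) :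
    IsLeast {J : Order.Ideal (Set ℕ) | A ⊆ J ∧ ∀ X : Set ℕ, X.Finite → X ∈ J}
      (generatedIdeal A) := by
  refine ⟨⟨fun X hX => ⟨{X}, by simp, by simpa using hX, by simp⟩,
    fun X hX => ⟨∅, by simp, by simp, by simpa using hX⟩⟩, ?_⟩
  rintro J ⟨hA, hfin⟩ X ⟨F, hF, hFA, hX⟩
  have hU : ⋃₀ F ∈ J := by
    clear hX
    induction F, hF using Set.Finite.induction_on with
    | empty => simpa using hfin ∅ Set.finite_empty
    | @insert a s _ _ ih =>
      rw [Set.sUnion_insert]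
      exact Order.Ideal.sup_mem (hA (hFA (Set.mem_insert _ _)))
        (ih ((Set.subset_insert _ _).trans hFA))
  exact J.lower (fun x hx => by
    by_cases h : x ∈ ⋃₀ F
    · exact Or.inr h
    · exact Or.inl ⟨hx, h⟩) (Order.Ideal.sup_mem (hfin _ hX) hU)

/-- `𝓘⁺`, the family of `𝓘`-positive sets. -/
def positive (I : Order.Ideal (Set ℕ)) : Set (Set ℕ) := {X | X ∉ I}

/-- The set of immediate successors `suc_T(s)` of a node. -/
def successors (T : Descriptive.tree ℕ) (s : List ℕ) : Set ℕ := {n | s ++ [n] ∈ T}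

/-- A nonempty tree all of whose nodes have their successor set in `𝒳`. -/
def IsBranching (𝒳 : Set (Set ℕ)) (T : Descriptive.tree ℕ) : Prop :=
  [] ∈ T ∧ ∀ s ∈ T, successors T s ∈ 𝒳

/-- The set `[T]` of branches: those `f : ω → ω` all of whose finite restrictions
`⟨f 0, …, f (n - 1)⟩` lie in `T`. -/
def branches (T : Descriptive.tree ℕ) : Set (ℕ → ℕ) :=
  {f | ∀ n : ℕ, (List.range n).map f ∈ T}

/-- Every `𝓘(A)⁺`-branching tree has a branch whose image is in `𝓘(A)⁺`. -/
def IsPlusRamsey (A : Set (Set ℕ)) : Prop :=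
  ∀ T : Descriptive.tree ℕ, IsBranching (positive (generatedIdeal A)) T →
    ∃ f ∈ branches T, Set.range f ∈ positive (generatedIdeal A)

/-- Every infinite subset of `ω` has infinite intersection with a member of `I`. -/
def IsTall (I : Order.Ideal (Set ℕ)) : Prop :=
  ∀ X : Set ℕ, X.Infinite → ∃ Y ∈ I, (X ∩ Y).Infinite

end PlusRamsey

namespace PlusRamsey

open Set Filter

/-! The family is built by a recursion of length continuum that handles one tree per step. Fix a
splitting family of sets `S b`, `b < 𝔰`. Each member carries a node, a binary sequence of length
less than `𝔰`, and is almost contained in the side of `S b` that its node names; different members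
have different nodes. Incompatible nodes force almost disjointness. Below a given node there are
fewer than `𝔰 ≤ 𝔞` members, since restrictions are determined by their length, so every positive set
contains an infinite set almost disjoint from all of them. A new member thus only needs a node with
no old node above it. A Cantor scheme splits a positive set into continuum many positive sets with
incompatible nodes, and an old node lies above at most one of these. As long as the family is
smaller than the continuum, infinitely many nodes are free, and tallness shrinks the new sets into
the ideal (`IsGood.exists_extension`).

The core is `IsGood.exists_positive_branch`. Skeletons of subtrees now play the role of positive
sets, and thinness, witnessed by an ordinal rank, that of smallness: along a branch of a skeleton
thin for `U`, the values in `U` eventually lie in prescribed sets of the ideal. No skeleton is thin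
for both sides of every `S b` (`Skeleton.exists_not_thin`), so there is a Cantor scheme of
skeletons, and one of its paths has nodes that are not all below the node of a single member. Each
member is then controlled by a small set attached to the path, fewer than `𝔰` of them at each stage.
As fewer than `𝔰` functions are not dominating, the values can be chosen to escape any finitely many
of these sets infinitely often.

Infinitely many new members inside the range of the branch keep it positive for good. Maximality
follows by applying this to the tree of all finite sequences in a positive set. -/

/-! ### Positive sets of an almost disjoint family -/

theorem generatedIdeal_mono_family {A B : Set (Set ℕ)} (h : A ⊆ B) {X : Set ℕ}
    (hX : X ∈ generatedIdeal A) : X ∈ generatedIdeal B := by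
  obtain ⟨F, hF, hFA, hX⟩ := hX
  exact ⟨F, hF, hFA.trans h, hX⟩

theorem mem_generatedIdeal_of_subset {A : Set (Set ℕ)} {X Y : Set ℕ}
    (hY : Y ∈ generatedIdeal A) (h : X ⊆ Y) : X ∈ generatedIdeal A :=
  (generatedIdeal A).lower h hY

theorem union_mem_generatedIdeal {A : Set (Set ℕ)} {X Y : Set ℕ}
    (hX : X ∈ generatedIdeal A) (hY : Y ∈ generatedIdeal A) : X ∪ Y ∈ generatedIdeal A :=
  Order.Ideal.sup_mem hX hY

theorem finite_mem_generatedIdeal {A : Set (Set ℕ)} {X : Set ℕ} (hX : X.Finite) :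
    X ∈ generatedIdeal A :=
  (isLeast_generatedIdeal A).1.2 X hX

/-- A set which is almost contained in a member of the ideal belongs to the ideal. -/
theorem mem_generatedIdeal_of_sdiff_finite {A : Set (Set ℕ)} {X Y : Set ℕ}
    (hY : Y ∈ generatedIdeal A) (h : (X \ Y).Finite) : X ∈ generatedIdeal A := by
  refine mem_generatedIdeal_of_subset (union_mem_generatedIdeal hY (finite_mem_generatedIdeal h)) ?_
  intro x hx
  by_cases hxY : x ∈ Y
  · exact Or.inl hxY
  · exact Or.inr ⟨hx, hxY⟩

/-- A finite union of sets each of which has finite intersection with `X`. -/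
theorem finite_inter_sUnion {X : Set ℕ} {F : Set (Set ℕ)} (hF : F.Finite)
    (h : ∀ B ∈ F, (X ∩ B).Finite) : (X ∩ ⋃₀ F).Finite := by
  rw [sUnion_eq_biUnion, inter_iUnion₂]
  exact hF.biUnion h

/-- If `X` is almost disjoint from all members of `F`, then so it is from all sets almost covered
by `F`. -/
theorem finite_inter_of_cover {X Y : Set ℕ} {F : Set (Set ℕ)} (hF : F.Finite)
    (hY : (Y \ ⋃₀ F).Finite) (h : ∀ B ∈ F, (X ∩ B).Finite) : (X ∩ Y).Finite := by
  refine ((finite_inter_sUnion hF h).union hY).subset ?_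
  rintro x ⟨hx, hxY⟩
  by_cases hxF : x ∈ ⋃₀ F
  · exact Or.inl ⟨hx, hxF⟩
  · exact Or.inr ⟨hxY, hxF⟩

theorem exists_infinite_inter_of_cover {X : Set ℕ} (hX : X.Infinite) {F : Set (Set ℕ)}
    (hF : F.Finite) (h : (X \ ⋃₀ F).Finite) : ∃ B ∈ F, (X ∩ B).Infinite := by
  by_contra hcon
  push Not at hcon
  refine hX ?_
  have := finite_inter_of_cover (X := X) (Y := X) hF h fun B hB => by simpa using hcon B hB
  simpa using this

/-- A set meeting infinitely many members of an almost disjoint family in an infinite set is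
positive. -/
theorem notMem_generatedIdeal_of_infinite_meets {A : Set (Set ℕ)} (hA : IsAD A) {W : Set ℕ}
    (hW : {B ∈ A | (W ∩ B).Infinite}.Infinite) : W ∉ generatedIdeal A := by
  rintro ⟨F, hF, hFA, hWF⟩
  refine hW (hF.subset ?_)
  rintro B ⟨hB, hWB⟩
  by_contra hBF
  refine hWB ?_
  rw [inter_comm]
  refine finite_inter_of_cover hF hWF fun C hC => ?_
  exact hA.2 hB (hFA hC) fun h => hBF (h ▸ hC)

/-- Every positive set contains a sequence of infinite sets such that all sets with infinite
intersection with infinitely many of them are positive. -/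
theorem exists_seq_of_notMem_generatedIdeal {A : Set (Set ℕ)} (hA : IsAD A) {X : Set ℕ}
    (hX : X ∉ generatedIdeal A) :
    ∃ Y : ℕ → Set ℕ, (∀ m, (Y m).Infinite) ∧ (∀ m, Y m ⊆ X) ∧
      ∀ W : Set ℕ, {m | (W ∩ Y m).Infinite}.Infinite → W ∉ generatedIdeal A := by
  by_cases hinf : {B ∈ A | (X ∩ B).Infinite}.Infinite
  · let e := hinf.natEmbedding
    refine ⟨fun m => X ∩ (e m : Set ℕ), fun m => (e m).2.2, fun m => inter_subset_left, ?_⟩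
    intro W hW
    refine notMem_generatedIdeal_of_infinite_meets hA ?_
    have hinj : Function.Injective fun m => (e m : Set ℕ) :=
      Subtype.val_injective.comp e.injective
    refine (hW.image hinj.injOn).mono ?_
    rintro _ ⟨m, hm, rfl⟩
    refine ⟨(e m).2.1, Set.Infinite.mono ?_ hm⟩
    exact inter_subset_inter_right _ inter_subset_right
  · rw [not_infinite] at hinf
    set F := {B ∈ A | (X ∩ B).Infinite} with hFdef
    have hFA : F ⊆ A := fun B hB => hB.1
    have hX' : (X \ ⋃₀ F).Infinite := fun h => hX ⟨F, hinf, hFA, h⟩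
    refine ⟨fun _ => X \ ⋃₀ F, fun _ => hX', fun _ => sdiff_subset, ?_⟩
    intro W hW hWA
    obtain ⟨m, hm⟩ := hW.nonempty
    obtain ⟨F', hF', hFA', hWF⟩ := hWA
    obtain ⟨B, hB, hBi⟩ := exists_infinite_inter_of_cover hm hF'
      (hWF.subset (sdiff_subset_sdiff_left inter_subset_left))
    have hBF : B ∈ F := ⟨hFA' hB, hBi.mono fun x hx => ⟨hx.1.2.1, hx.2⟩⟩
    obtain ⟨x, hx⟩ := hBi.nonempty
    exact hx.1.2.2 ⟨B, hBF, hx.2⟩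

/-- For infinite sets `W k` there is a strictly increasing sequence of points `z k ∈ W k`. -/
theorem exists_strictMono_mem {W : ℕ → Set ℕ} (hW : ∀ k, (W k).Infinite) :
    ∃ z : ℕ → ℕ, StrictMono z ∧ ∀ k, z k ∈ W k :=
  Filter.extraction_forall_of_frequently fun k => Nat.frequently_atTop_iff_infinite.2 (hW k)

/-- A decreasing sequence of positive sets has a positive pseudo-intersection. -/
theorem exists_pseudointersection {A : Set (Set ℕ)} (hA : IsAD A) {Y : ℕ → Set ℕ}
    (hY : ∀ k, Y k ∉ generatedIdeal A) (hanti : Antitone Y) :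
    ∃ Z, Z ∉ generatedIdeal A ∧ Z ⊆ Y 0 ∧ ∀ k, (Z \ Y k).Finite := by
  have key : ∀ z : ℕ → ℕ, (∀ k, z k ∈ Y k) → range z ⊆ Y 0 ∧ ∀ k, (range z \ Y k).Finite := by
    intro z hz
    refine ⟨?_, fun k => ?_⟩
    · rintro _ ⟨k, rfl⟩
      exact hanti (Nat.zero_le k) (hz k)
    · refine ((finite_Iio k).image z).subset ?_
      rintro _ ⟨⟨m, rfl⟩, hm⟩
      refine ⟨m, ?_, rfl⟩
      by_contra hkm
      exact hm (hanti (not_lt.1 hkm) (hz m))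
  set C := {B ∈ A | ∀ k, (Y k ∩ B).Infinite} with hC
  by_cases hfin : C.Finite
  -- A member meeting the pseudo-intersection in an infinite set meets every `Y k` so, hence lies in
  -- `C`; it suffices to avoid `⋃₀ C`.
  · have hW : ∀ k, (Y k \ ⋃₀ C).Infinite := fun k h => hY k ⟨C, hfin, fun B hB => hB.1, h⟩
    obtain ⟨z, hz, hzW⟩ := exists_strictMono_mem hW
    refine ⟨range z, ?_, key z fun k => (hzW k).1⟩
    rintro ⟨F, hF, hFA, hzF⟩
    obtain ⟨B, hB, hBi⟩ :=
      exists_infinite_inter_of_cover (infinite_range_of_injective hz.injective) hF hzF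
    have hBC : B ∈ C := by
      refine ⟨hFA hB, fun k hk => hBi ?_⟩
      refine (hk.union ((key z fun k => (hzW k).1).2 k)).subset ?_
      rintro x ⟨hx, hxB⟩
      by_cases hxY : x ∈ Y k
      · exact Or.inl ⟨hxY, hxB⟩
      · exact Or.inr ⟨hx, hxY⟩
    obtain ⟨_, ⟨m, rfl⟩, hm⟩ := hBi.nonempty
    exact (hzW m).2 ⟨B, hBC, hm⟩
  · let e := Set.Infinite.natEmbedding C hfin
    -- Every `i` is the first coordinate of infinitely many `k`, so the range of `z` meets each `e
    -- i` in an infinite set.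
    obtain ⟨z, hz, hzW⟩ := exists_strictMono_mem
      (W := fun k => Y k ∩ (e k.unpair.1 : Set ℕ)) fun k => (e _).2.2 k
    refine ⟨range z, ?_, key z fun k => (hzW k).1⟩
    refine notMem_generatedIdeal_of_infinite_meets hA ?_
    have hinj : Function.Injective fun m => (e m : Set ℕ) :=
      Subtype.val_injective.comp e.injective
    refine (infinite_range_of_injective hinj).mono ?_
    rintro _ ⟨i, rfl⟩
    refine ⟨(e i).2.1, ?_⟩
    have : Function.Injective fun m => z (Nat.pair i m) := by
      intro m m' h
      have := hz.injective h
      simpa using this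
    refine (infinite_range_of_injective this).mono ?_
    rintro _ ⟨m, rfl⟩
    refine ⟨⟨_, rfl⟩, ?_⟩
    have := (hzW (Nat.pair i m)).2
    simpa using this

/-- Fewer than `𝔞` members of an almost disjoint family are not maximal below a positive set. -/
theorem exists_infinite_subset_almostDisjoint {A : Set (Set ℕ)} (hA : IsAD A) {B : Set (Set ℕ)}
    (hBA : B ⊆ A) (hB : Cardinal.mk B < almostDisjointnessNumber) {Y : Set ℕ}
    (hY : Y ∉ generatedIdeal A) :
    ∃ Z ⊆ Y, Z.Infinite ∧ ∀ X ∈ B, (Z ∩ X).Finite := by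
  set C := {X ∈ B | (Y ∩ X).Infinite} with hC
  have hCB : C ⊆ B := fun X hX => hX.1
  by_cases hfin : C.Finite
  · refine ⟨Y \ ⋃₀ C, sdiff_subset, fun h => hY ⟨C, hfin, hCB.trans hBA, h⟩, fun X hX => ?_⟩
    by_cases hXC : X ∈ C
    · convert Set.finite_empty
      ext x
      simp only [mem_inter_iff, Set.mem_sdiff, mem_empty_iff_false, iff_false]
      exact fun hx => hx.1.2 ⟨X, hXC, hx.2⟩
    · have : (Y ∩ X).Finite := by
        by_contra h
        exact hXC ⟨hX, h⟩
      exact this.subset (inter_subset_inter_left _ sdiff_subset)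
  -- The infinite traces on `Y` form an infinite almost disjoint family of size less than `𝔞`, which
  -- is not maximal. Adding `Yᶜ`, if infinite, forces any further set to be almost contained in `Y`.
  · set D : Set (Set ℕ) := (fun X => Y ∩ X) '' C ∪ {X | X = Yᶜ ∧ X.Infinite} with hD
    have hinj : InjOn (fun X => Y ∩ X) C := by
      intro X hX X' hX' h
      by_contra hne
      have : (X ∩ X').Finite := hA.2 (hBA hX.1) (hBA hX'.1) hne
      refine hX.2 (this.subset ?_)
      intro x hx
      have hx' : x ∈ Y ∩ X' := by
        have h : Y ∩ X = Y ∩ X' := h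
        exact h ▸ hx
      exact ⟨hx.2, hx'.2⟩
    have hDinf : D.Infinite := (Set.Infinite.image hinj hfin).mono subset_union_left
    have hDcard : Cardinal.mk D < almostDisjointnessNumber := by
      have hCinf : Cardinal.aleph0 ≤ Cardinal.mk C := by
        rw [Cardinal.aleph0_le_mk_iff]
        exact Set.infinite_coe_iff.2 hfin
      have h1 : Cardinal.mk {X : Set ℕ | X = Yᶜ ∧ X.Infinite} ≤ 1 := by
        refine (Cardinal.mk_le_mk_of_subset (t := {Yᶜ}) fun X hX => hX.1).trans ?_
        simp
      calc Cardinal.mk D ≤ Cardinal.mk ((fun X => Y ∩ X) '' C) +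
              Cardinal.mk {X : Set ℕ | X = Yᶜ ∧ X.Infinite} := Cardinal.mk_union_le _ _
        _ ≤ Cardinal.mk C + 1 := add_le_add Cardinal.mk_image_le h1
        _ = Cardinal.mk C := Cardinal.add_one_eq hCinf
        _ ≤ Cardinal.mk B := Cardinal.mk_le_mk_of_subset hCB
        _ < _ := hB
    have hDAD : IsAD D := by
      refine ⟨?_, ?_⟩
      · rintro _ (⟨X, hX, rfl⟩ | hX)
        · exact hX.2
        · exact hX.2
      · rintro _ (⟨X, hX, rfl⟩ | ⟨rfl, hX⟩) _ (⟨X', hX', rfl⟩ | ⟨rfl, hX'⟩) hne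
        · have : X ≠ X' := fun h => hne (by rw [h])
          refine (hA.2 (hBA hX.1) (hBA hX'.1) this).subset ?_
          exact inter_subset_inter inter_subset_right inter_subset_right
        · convert Set.finite_empty
          ext x
          simp only [mem_inter_iff, mem_compl_iff, mem_empty_iff_false, iff_false]
          tauto
        · convert Set.finite_empty
          ext x
          simp only [mem_inter_iff, mem_compl_iff, mem_empty_iff_false, iff_false]
          tauto
        · exact absurd rfl hne
    have hnot : ¬ Maximal IsAD D := fun h =>
      absurd (csInf_le' (s := {κ | ∃ A : Set (Set ℕ), IsMAD A ∧ Cardinal.mk A = κ})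
        ⟨D, ⟨hDinf, h⟩, rfl⟩) (not_le.2 hDcard)
    have : ∃ D', IsAD D' ∧ D ⊆ D' ∧ ¬ D' ⊆ D := by
      by_contra hcon
      push Not at hcon
      exact hnot ⟨hDAD, fun D' hD' hle => hcon D' hD' hle⟩
    obtain ⟨D', hD', hDD', hne⟩ := this
    obtain ⟨Z, hZ, hZD⟩ := not_subset.1 hne
    have hZfin : ∀ X ∈ D, (Z ∩ X).Finite := fun X hX =>
      hD'.2 hZ (hDD' hX) fun h => hZD (h ▸ hX)
    have hZY : (Z \ Y).Finite := by
      by_cases hYc : Yᶜ.Infinite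
      · exact hZfin Yᶜ (Or.inr ⟨rfl, hYc⟩)
      · rw [not_infinite] at hYc
        exact hYc.subset fun x hx => hx.2
    refine ⟨Z ∩ Y, inter_subset_right, fun h => hD'.1 Z hZ ?_, fun X hX => ?_⟩
    · refine (h.union hZY).subset fun x hx => ?_
      by_cases hxY : x ∈ Y
      · exact Or.inl ⟨hx, hxY⟩
      · exact Or.inr ⟨hx, hxY⟩
    · by_cases hYX : (Y ∩ X).Infinite
      · have := hZfin (Y ∩ X) (Or.inl ⟨X, ⟨hX, hYX⟩, rfl⟩)
        rwa [inter_assoc]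
      · rw [not_infinite] at hYX
        exact hYX.subset fun x hx => ⟨hx.1.2, hx.2⟩

/-! ### Interval partitions, growth of functions and the splitting number -/

/-- The union of the intervals `[e n, e (n + 1))` with `n ∈ D`. -/
def blockSet (e : ℕ → ℕ) (D : Set ℕ) : Set ℕ := {x | ∃ n ∈ D, e n ≤ x ∧ x < e (n + 1)}

theorem block_unique {e : ℕ → ℕ} (he : StrictMono e) {x m n : ℕ} (hm : e m ≤ x)
    (hm' : x < e (m + 1)) (hn : e n ≤ x) (hn' : x < e (n + 1)) : m = n := by
  have h1 := he.lt_iff_lt.1 (hm.trans_lt hn')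
  have h2 := he.lt_iff_lt.1 (hn.trans_lt hm')
  omega

theorem splits_blockSet {e : ℕ → ℕ} (he : StrictMono e) {X D E : Set ℕ}
    (hE : ∀ n ∈ E, ∃ x ∈ X, e n ≤ x ∧ x < e (n + 1)) (h1 : (E ∩ D).Infinite)
    (h2 : (E \ D).Infinite) : Splits (blockSet e D) X := by
  choose! x hxX hxl hxr using hE
  have hinj : InjOn x E := by
    intro m hm n hn h
    exact block_unique he (hxl m hm) (hxr m hm) (h ▸ hxl n hn) (h ▸ hxr n hn)
  refine ⟨(h1.image (hinj.mono inter_subset_left)).mono ?_,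
    (h2.image (hinj.mono sdiff_subset)).mono ?_⟩
  · rintro _ ⟨n, ⟨hn, hnD⟩, rfl⟩
    exact ⟨⟨n, hnD, hxl n hn, hxr n hn⟩, hxX n hn⟩
  · rintro _ ⟨n, ⟨hn, hnD⟩, rfl⟩
    refine ⟨hxX n hn, ?_⟩
    rintro ⟨m, hm, hml, hmr⟩
    exact hnD (block_unique he hml hmr (hxl n hn) (hxr n hn) ▸ hm)

/-- A strictly increasing function above `f`. -/
def majorant (f : ℕ → ℕ) (n : ℕ) : ℕ := n + 1 + ∑ m ∈ Finset.range (n + 1), f m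

theorem majorant_strictMono (f : ℕ → ℕ) : StrictMono (majorant f) := by
  refine strictMono_nat_of_lt_succ fun n => ?_
  unfold majorant
  rw [Finset.sum_range_succ _ (n + 1)]
  omega

theorem le_majorant (f : ℕ → ℕ) (n : ℕ) : f n ≤ majorant f n := by
  unfold majorant
  rw [Finset.sum_range_succ]
  omega

theorem lt_majorant (f : ℕ → ℕ) (n : ℕ) : n < majorant f n := by
  unfold majorant
  omega

/-- The iterates of `0` under the majorant of `f`. -/
def orbit (f : ℕ → ℕ) (n : ℕ) : ℕ := (majorant f)^[n] 0

theorem orbit_succ (f : ℕ → ℕ) (n : ℕ) : orbit f (n + 1) = majorant f (orbit f n) :=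
  Function.iterate_succ_apply' _ _ _

theorem orbit_strictMono (f : ℕ → ℕ) : StrictMono (orbit f) :=
  strictMono_nat_of_lt_succ fun n => by rw [orbit_succ]; exact lt_majorant f _

theorem exists_orbit_block (f : ℕ → ℕ) (x : ℕ) : ∃ n, orbit f n ≤ x ∧ x < orbit f (n + 1) := by
  classical
  have h : ∃ n, x < orbit f n := ⟨x + 1, (orbit_strictMono f).le_apply⟩
  have h0 : Nat.find h ≠ 0 := by
    intro h0
    have := Nat.find_spec h
    rw [h0] at this
    exact absurd this (by simp [orbit])
  obtain ⟨n, hn⟩ := Nat.exists_eq_succ_of_ne_zero h0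
  refine ⟨n, not_lt.1 (Nat.find_min h (by omega)), ?_⟩
  have := Nat.find_spec h
  rwa [hn] at this

theorem exists_splits {X : Set ℕ} (hX : X.Infinite) : ∃ S, Splits S X := by
  let e := hX.natEmbedding
  have he : Function.Injective fun n => (e n : ℕ) := Subtype.val_injective.comp e.injective
  refine ⟨range fun n => (e (2 * n) : ℕ), ?_, ?_⟩
  · have : Function.Injective fun n => (e (2 * n) : ℕ) := fun m n h => by
      have := he h
      omega
    refine (infinite_range_of_injective this).mono ?_
    rintro _ ⟨n, rfl⟩
    exact ⟨⟨n, rfl⟩, (e _).2⟩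
  · have : Function.Injective fun n => (e (2 * n + 1) : ℕ) := fun m n h => by
      have := he h
      omega
    refine (infinite_range_of_injective this).mono ?_
    rintro _ ⟨n, rfl⟩
    refine ⟨(e _).2, ?_⟩
    rintro ⟨m, hm⟩
    have := he hm
    omega

theorem exists_splittingFamily :
    ∃ 𝒮 : Set (Set ℕ), IsSplittingFamily 𝒮 ∧ Cardinal.mk 𝒮 = splittingNumber := by
  refine csInf_mem (s := {κ | ∃ 𝒮 : Set (Set ℕ), IsSplittingFamily 𝒮 ∧ Cardinal.mk 𝒮 = κ})
    ⟨_, {S | S.Infinite}, ⟨fun S hS => hS, fun X hX => ?_⟩, rfl⟩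
  obtain ⟨S, hS⟩ := exists_splits hX
  exact ⟨S, hS.1.mono inter_subset_left, hS⟩

theorem exists_unsplit_of_lt {ι : Type} (hι : Cardinal.mk ι < splittingNumber)
    (S : ι → Set ℕ) : ∃ X : Set ℕ, X.Infinite ∧ ∀ i, ¬ Splits (S i) X := by
  by_contra hcon
  push Not at hcon
  have hfam : IsSplittingFamily {T ∈ range S | T.Infinite} := by
    refine ⟨fun T hT => hT.2, fun X hX => ?_⟩
    obtain ⟨i, hi⟩ := hcon X hX
    exact ⟨S i, ⟨⟨i, rfl⟩, hi.1.mono inter_subset_left⟩, hi⟩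
  have h1 : splittingNumber ≤ Cardinal.mk {T ∈ range S | T.Infinite} :=
    csInf_le' ⟨_, hfam, rfl⟩
  refine absurd (h1.trans ?_) (not_le.2 hι)
  exact (Cardinal.mk_le_mk_of_subset fun T hT => hT.1).trans Cardinal.mk_range_le

/-- Being unsplit passes to infinite subsets, so one can shrink to one side of each set in turn. -/
theorem exists_unsplit_of_finite {𝒮 : Set (Set ℕ)} (h𝒮 : 𝒮.Finite) :
    ∃ X : Set ℕ, X.Infinite ∧ ∀ S ∈ 𝒮, ¬ Splits S X := by
  induction 𝒮, h𝒮 using Set.Finite.induction_on with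
  | empty => exact ⟨univ, infinite_univ, by simp⟩
  | @insert S 𝒮 _ _ ih =>
    obtain ⟨X, hX, hXS⟩ := ih
    have mono : ∀ Y ⊆ X, ∀ T ∈ 𝒮, ¬ Splits T Y := fun Y hY T hT h => hXS T hT
      ⟨h.1.mono (inter_subset_inter_right _ hY), h.2.mono (sdiff_subset_sdiff_left hY)⟩
    by_cases hS : (X ∩ S).Infinite
    · refine ⟨X ∩ S, hS, ?_⟩
      rintro T (rfl | hT)
      · rintro ⟨-, h⟩
        obtain ⟨x, hx⟩ := h.nonempty
        exact hx.2 hx.1.2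
      · exact mono _ inter_subset_left T hT
    · refine ⟨X, hX, ?_⟩
      rintro T (rfl | hT)
      · rintro ⟨h, -⟩
        exact hS (by rwa [inter_comm])
      · exact hXS T hT

theorem aleph0_le_splittingNumber : Cardinal.aleph0 ≤ splittingNumber := by
  by_contra hcon
  obtain ⟨𝒮, h𝒮, hcard⟩ := exists_splittingFamily
  rw [not_le, ← hcard, Cardinal.lt_aleph0_iff_set_finite] at hcon
  obtain ⟨X, hX, h⟩ := exists_unsplit_of_finite hcon
  obtain ⟨S, hS, hSX⟩ := h𝒮.2 X hX
  exact h S hS hSX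

/-- An unbounded family of functions and a splitting family together yield, for each sequence of
infinite sets, one block set that splits all of them. -/
theorem exists_blockSet_splits_seq {ι κ : Type} {f : ι → ℕ → ℕ}
    (hf : ∀ H : ℕ → ℕ, ∃ i, ∃ᶠ n in atTop, H n < f i n) {S : κ → Set ℕ}
    (hS : ∀ X : Set ℕ, X.Infinite → ∃ k, Splits (S k) X) {X : ℕ → Set ℕ}
    (hX : ∀ m, (X m).Infinite) :
    ∃ i k, ∀ m, Splits (blockSet (orbit (f i)) (S k)) (X m) := by
  choose a haX ha using fun m k => (hX m).exists_gt k
  -- For every `m ≤ k`, the set `X m` has an element strictly between `k` and `g k`.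
  let g : ℕ → ℕ := majorant fun k => ∑ m ∈ Finset.range (k + 1), a m k
  have hg : ∀ m k, m ≤ k → a m k < g k := by
    intro m k hmk
    have h1 : a m k ≤ ∑ m ∈ Finset.range (k + 1), a m k :=
      Finset.single_le_sum (f := fun m => a m k) (fun _ _ => Nat.zero_le _)
        (Finset.mem_range.2 (by omega))
    have h2 : ∑ j ∈ Finset.range (k + 1), ∑ m ∈ Finset.range (j + 1), a m j
        ≥ ∑ m ∈ Finset.range (k + 1), a m k := by
      rw [Finset.sum_range_succ]
      exact Nat.le_add_left _ _
    change a m k < k + 1 + ∑ j ∈ Finset.range (k + 1), ∑ m ∈ Finset.range (j + 1), a m j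
    omega
  have hgmono : StrictMono g := majorant_strictMono _
  have hglt : ∀ k, k < g k := lt_majorant _
  -- Iterating `g` allows for an endpoint between `k` and `g k`: then the following block still
  -- contains everything from `g k` up to `g (g k)`.
  obtain ⟨i, hi⟩ := hf fun k => g (g k)
  let e := orbit (f i)
  have he : StrictMono e := orbit_strictMono _
  let D : Set ℕ := {n | ∀ m ≤ n, ∃ x ∈ X m, e n ≤ x ∧ x < e (n + 1)}
  have hblock : ∀ n k, e n ≤ k → g k ≤ e (n + 1) → n ∈ D := by
    intro n k h1 h2 m hm
    have hnk : n ≤ k := he.le_apply.trans h1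
    exact ⟨a m k, haX m k, h1.trans (ha m k).le, (hg m k (hm.trans hnk)).trans_le h2⟩
  have hD : D.Infinite := by
    refine infinite_of_not_bddAbove ?_
    rintro ⟨b, hb⟩
    obtain ⟨k, hbk, hk⟩ := Filter.frequently_atTop.1 hi (e (b + 1))
    obtain ⟨n, hn1, hn2⟩ := exists_orbit_block (f i) k
    have hbn : b < n := by
      have h3 := he.lt_iff_lt.1 (hbk.trans_lt hn2 : e (b + 1) < e (n + 1))
      omega
    by_cases hcase : g k ≤ e (n + 1)
    · exact absurd (hb (hblock n k hn1 hcase)) (by omega)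
    · have h4 : g (g k) ≤ e (n + 2) := by
        have h5 : f i k ≤ majorant (f i) k := le_majorant _ _
        have h6 : majorant (f i) k < majorant (f i) (e (n + 1)) :=
          majorant_strictMono _ hn2
        have h7 : e (n + 2) = majorant (f i) (e (n + 1)) := orbit_succ _ _
        omega
      exact absurd (hb (hblock (n + 1) (g k) (by omega) h4)) (by omega)
  obtain ⟨k, hk⟩ := hS D hD
  refine ⟨i, k, fun m => ?_⟩
  refine splits_blockSet he (E := {n ∈ D | m ≤ n}) (fun n hn => hn.1 m hn.2) ?_ ?_
  · refine (hk.1.sdiff (finite_Iio m)).mono ?_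
    rintro n ⟨⟨hnS, hnD⟩, hn⟩
    exact ⟨⟨hnD, not_lt.1 hn⟩, hnS⟩
  · refine (hk.2.sdiff (finite_Iio m)).mono ?_
    rintro n ⟨⟨hnD, hnS⟩, hn⟩
    exact ⟨⟨hnD, not_lt.1 hn⟩, hnS⟩

/-- Fewer than `𝔰` functions do not form a dominating family. -/
theorem exists_not_dominated {ι : Type} (hι : Cardinal.mk ι < splittingNumber)
    (h : ι → ℕ → ℕ) : ∃ φ : ℕ → ℕ, ∀ i, ∃ᶠ x in atTop, h i x < φ x := by
  classical
  obtain ⟨X, hX, hXh⟩ := exists_unsplit_of_lt hι fun i => blockSet (orbit (h i)) {n | Even n}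
  -- If `h i` eventually bounds the next-element function of `X`, then `X` meets all later blocks,
  -- and the union of the even blocks splits it.
  refine ⟨fun x => sInf {y ∈ X | x < y}, fun i => ?_⟩
  by_contra hcon
  rw [not_frequently] at hcon
  obtain ⟨x₀, hx₀⟩ := eventually_atTop.1 hcon
  obtain ⟨y₁, hy₁, hy₁'⟩ := hX.exists_gt x₀
  refine hXh i ?_
  let e := orbit (h i)
  have he : StrictMono e := orbit_strictMono _
  refine splits_blockSet he (E := Ioi y₁) ?_ ?_ ?_
  · intro n hn
    by_contra hno
    push Not at hno
    have hyn : y₁ ≤ e n - 1 := by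
      have h1 : n ≤ e n := he.le_apply
      have h2 : y₁ < n := hn
      omega
    -- The last element of `X` before the block that `X` allegedly misses; the next element `z` is
    -- at most `h i y`, too small to jump over the block.
    set y := Nat.findGreatest (· ∈ X) (e n - 1) with hy
    have hyX : y ∈ X := Nat.findGreatest_spec (P := (· ∈ X)) hyn hy₁
    have hyle : y ≤ e n - 1 := Nat.findGreatest_le _
    have hy1 : y₁ ≤ y := Nat.le_findGreatest hyn hy₁
    have hne : {z ∈ X | y < z}.Nonempty := by
      obtain ⟨z, hz, hz'⟩ := hX.exists_gt y
      exact ⟨z, hz, hz'⟩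
    obtain ⟨hzX, hyz⟩ := Nat.sInf_mem hne
    have hle : sInf {z ∈ X | y < z} ≤ h i y := not_lt.1 (hx₀ y (by omega))
    set z := sInf {z ∈ X | y < z} with hz
    have hzn : e n ≤ z := by
      by_contra hlt
      exact Nat.findGreatest_is_greatest (P := (· ∈ X)) hyz (by omega) hzX
    have h1 := hno z hzX hzn
    have h2 : h i y ≤ majorant (h i) y := le_majorant _ _
    have h3 : majorant (h i) y < majorant (h i) (e n) := majorant_strictMono _ (by omega)
    have h4 : e (n + 1) = majorant (h i) (e n) := orbit_succ _ _
    omega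
  · refine infinite_of_not_bddAbove ?_
    rintro ⟨b, hb⟩
    have := hb (show 2 * (b + y₁ + 1) ∈ Ioi y₁ ∩ {n | Even n} from
      ⟨by simp only [mem_Ioi]; omega, even_two_mul _⟩)
    omega
  · refine infinite_of_not_bddAbove ?_
    rintro ⟨b, hb⟩
    have := hb (show 2 * (b + y₁ + 1) + 1 ∈ Ioi y₁ \ {n | Even n} from
      ⟨by simp only [mem_Ioi]; omega, by simp⟩)
    omega

/-- For countably many families of fewer than `𝔰` functions there is a sequence that infinitely
often grows faster than each of them. -/
theorem exists_strictMono_escaping {ι : ℕ → Type}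
    (hι : ∀ m, Cardinal.mk (ι m) < splittingNumber) (h : ∀ m, ι m → ℕ → ℕ) :
    ∃ g : ℕ → ℕ, StrictMono g ∧ ∀ m i, ∃ᶠ k in atTop, h m i (g k) < g (k + 1) := by
  -- The majorant is iterated for the case that the first gap of the orbit around `x` is too short:
  -- then the next gap is long enough.
  choose φ hφ using fun m => exists_not_dominated (hι m)
    fun i x => majorant (h m i) (majorant (h m i) x)
  let ψ : ℕ → ℕ := fun x => ∑ m ∈ Finset.range (x + 1), φ m x
  have hψ : ∀ m i, ∃ᶠ x in atTop, majorant (h m i) (majorant (h m i) x) < ψ x := by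
    intro m i
    refine ((hφ m i).and_eventually (eventually_ge_atTop m)).mono ?_
    rintro x ⟨hx, hmx⟩
    refine hx.trans_le ?_
    exact Finset.single_le_sum (f := fun m => φ m x) (fun _ _ => Nat.zero_le _)
        (Finset.mem_range.2 (by omega))
  refine ⟨orbit ψ, orbit_strictMono _, fun m i => ?_⟩
  rw [frequently_atTop]
  intro k₀
  obtain ⟨x, hx, hxψ⟩ := frequently_atTop.1 (hψ m i) (orbit ψ k₀)
  obtain ⟨k, hk1, hk2⟩ := exists_orbit_block ψ x
  have hkk : k₀ ≤ k := by
    have := (orbit_strictMono ψ).lt_iff_lt.1 (hx.trans_lt hk2)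
    omega
  have hH : StrictMono (majorant (h m i)) := majorant_strictMono _
  have h1 := le_majorant (h m i) (orbit ψ k)
  by_cases hc : majorant (h m i) (orbit ψ k) < orbit ψ (k + 1)
  · exact ⟨k, hkk, by omega⟩
  · refine ⟨k + 1, by omega, ?_⟩
    have h2 : majorant (h m i) (orbit ψ k) ≤ majorant (h m i) x := hH.monotone hk1
    have h3 : majorant (h m i) (orbit ψ (k + 1)) ≤ majorant (h m i) (majorant (h m i) x) :=
      hH.monotone (by omega)
    have h4 := le_majorant (h m i) (orbit ψ (k + 1))
    have h5 := le_majorant ψ x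
    have h6 : majorant ψ x < majorant ψ (orbit ψ (k + 1)) := majorant_strictMono _ hk2
    rw [orbit_succ ψ (k + 1)]
    omega

/-! ### Strongly splitting families -/

/-- A family of sets indexed by `K` is strongly splitting if it splits all infinite sets, and
moreover either splits sequences of infinite sets simultaneously or all families of functions
indexed by `K` are bounded. -/
def IsStronglySplitting {K : Type} (S : K → Set ℕ) : Prop :=
  (∀ X : ℕ → Set ℕ, (∀ m, (X m).Infinite) → ∃ b, ∀ m, Splits (S b) (X m)) ∨
    ((∀ X : Set ℕ, X.Infinite → ∃ b, Splits (S b) X) ∧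
      ∀ h : K → ℕ → ℕ, ∃ H : ℕ → ℕ, ∀ b, ∀ᶠ n in atTop, h b n ≤ H n)

/-- If some `𝔰` functions are unbounded, their interval partitions combine with a splitting family
into block sets that split sequences; `𝔰 * 𝔰 = 𝔰` keeps the index set. Otherwise any splitting
family of size `𝔰` satisfies the second alternative. -/
theorem exists_isStronglySplitting {K : Type} (hK : Cardinal.mk K = splittingNumber) :
    ∃ S : K → Set ℕ, IsStronglySplitting S := by
  obtain ⟨𝒮, h𝒮, hcard⟩ := exists_splittingFamily
  obtain ⟨e⟩ := Cardinal.eq.1 (hK.trans hcard.symm)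
  have hS : ∀ X : Set ℕ, X.Infinite → ∃ b, Splits (e b : Set ℕ) X := by
    intro X hX
    obtain ⟨S, hS, hSX⟩ := h𝒮.2 X hX
    exact ⟨e.symm ⟨S, hS⟩, by simpa using hSX⟩
  by_cases hb : ∀ h : K → ℕ → ℕ, ∃ H : ℕ → ℕ, ∀ b, ∀ᶠ n in atTop, h b n ≤ H n
  · exact ⟨fun b => e b, Or.inr ⟨hS, hb⟩⟩
  · push Not at hb
    obtain ⟨f, hf⟩ := hb
    have hKK : Cardinal.mk K = Cardinal.mk (K × K) := by
      rw [Cardinal.mk_prod, Cardinal.lift_id, Cardinal.mul_eq_self]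
      rw [hK]
      exact aleph0_le_splittingNumber
    obtain ⟨p⟩ := Cardinal.eq.1 hKK
    refine ⟨fun b => blockSet (orbit (f (p b).1)) (e (p b).2), Or.inl fun X hX => ?_⟩
    obtain ⟨i, k, h⟩ := exists_blockSet_splits_seq (f := f) (S := fun b => (e b : Set ℕ))
      hf hS hX
    exact ⟨p.symm (i, k), by simpa using h⟩

/-! ### Skeletons of trees and thinness -/

/-- The splitting nodes of a tree of finite sequences in which above each successor of a splitting
node there is a splitting node, together with the positive sets of successors of these nodes. -/
structure Skeleton (A : Set (Set ℕ)) where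
  nodes : Set (List ℕ)
  succ : List ℕ → Set ℕ
  nonempty : nodes.Nonempty
  pos : ∀ t ∈ nodes, succ t ∉ generatedIdeal A
  ext : ∀ t ∈ nodes, ∀ n ∈ succ t, ∃ t' ∈ nodes, t ++ [n] <+: t'

namespace Skeleton

variable {A : Set (Set ℕ)}

/-- `q` is a subtree of `p`. -/
def Sub (q p : Skeleton A) : Prop :=
  q.nodes ⊆ p.nodes ∧ ∀ t ∈ q.nodes, q.succ t ⊆ p.succ t

theorem Sub.refl (p : Skeleton A) : p.Sub p := ⟨subset_rfl, fun _ _ => subset_rfl⟩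

theorem Sub.trans {p q r : Skeleton A} (h : r.Sub q) (h' : q.Sub p) : r.Sub p :=
  ⟨h.1.trans h'.1, fun t ht => (h.2 t ht).trans (h'.2 t (h.1 ht))⟩

/-- The part of a skeleton above a successor of one of its nodes. -/
def above (p : Skeleton A) (t : List ℕ) (ht : t ∈ p.nodes) (n : ℕ) (hn : n ∈ p.succ t) :
    Skeleton A where
  nodes := {t' ∈ p.nodes | t ++ [n] <+: t'}
  succ := p.succ
  nonempty := p.ext t ht n hn
  pos t' ht' := p.pos t' ht'.1
  ext t' ht' m hm := by
    obtain ⟨s, hs, hs'⟩ := p.ext t' ht'.1 m hm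
    exact ⟨s, ⟨hs, ht'.2.trans ((List.prefix_append _ _).trans hs')⟩, hs'⟩

theorem above_sub (p : Skeleton A) (t : List ℕ) (ht : t ∈ p.nodes) (n : ℕ)
    (hn : n ∈ p.succ t) : (p.above t ht n hn).Sub p :=
  ⟨fun _ h => h.1, fun _ _ => subset_rfl⟩

/-- The rank function `r` and the small sets `N t` witness that no subskeleton of `p` has all its
successor sets contained in `U`. -/
def ThinBy (p : Skeleton A) (U : Set ℕ) (r : List ℕ → Ordinal.{0}) (N : List ℕ → Set ℕ) : Prop :=
  (∀ t ∈ p.nodes, ∀ t' ∈ p.nodes, t <+: t' → r t' ≤ r t) ∧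
  (∀ t ∈ p.nodes, N t ∈ generatedIdeal A) ∧
  ∀ t ∈ p.nodes, ∀ n ∈ p.succ t, n ∈ U → n ∉ N t →
    ∀ t' ∈ p.nodes, t ++ [n] <+: t' → r t' < r t

/-- The skeleton `p` is thin with respect to `U`. -/
def Thin (p : Skeleton A) (U : Set ℕ) : Prop := ∃ r N, p.ThinBy U r N

theorem ThinBy.mono {p q : Skeleton A} {U : Set ℕ} {r : List ℕ → Ordinal.{0}}
    {N : List ℕ → Set ℕ} (h : p.ThinBy U r N) (hq : q.Sub p) : q.ThinBy U r N :=
  ⟨fun t ht t' ht' => h.1 t (hq.1 ht) t' (hq.1 ht'), fun t ht => h.2.1 t (hq.1 ht),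
    fun t ht n hn hU hN t' ht' => h.2.2 t (hq.1 ht) n (hq.2 t ht hn) hU hN t' (hq.1 ht')⟩

/-- The transfinite derivative: nodes surviving `α` steps of the removal of the nodes above which
there are only few successors in `U` leading to a remaining node. -/
def derivative (p : Skeleton A) (U : Set ℕ) (α : Ordinal.{0}) : Set (List ℕ) :=
  {t | t ∈ p.nodes ∧ ∀ β, ∀ _h : β < α, ∃ t' ∈ p.nodes, t <+: t' ∧
    {n | n ∈ p.succ t' ∧ n ∈ U ∧ ∃ s ∈ derivative p U β, t' ++ [n] <+: s} ∉ generatedIdeal A}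
termination_by α

/-- Above `t` there is a node with positively many successors in `U` below elements of `H`. -/
def Survives (p : Skeleton A) (U : Set ℕ) (H : Set (List ℕ)) (t : List ℕ) : Prop :=
  ∃ t' ∈ p.nodes, t <+: t' ∧
    {n | n ∈ p.succ t' ∧ n ∈ U ∧ ∃ s ∈ H, t' ++ [n] <+: s} ∉ generatedIdeal A

theorem mem_derivative {p : Skeleton A} {U : Set ℕ} {α : Ordinal.{0}} {t : List ℕ} :
    t ∈ p.derivative U α ↔ t ∈ p.nodes ∧ ∀ β < α, p.Survives U (p.derivative U β) t := by
  rw [derivative]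
  rfl

theorem derivative_anti {p : Skeleton A} {U : Set ℕ} {α β : Ordinal.{0}} (h : α ≤ β) :
    p.derivative U β ⊆ p.derivative U α := by
  intro t ht
  rw [mem_derivative] at ht ⊢
  exact ⟨ht.1, fun γ hγ => ht.2 γ (hγ.trans_le h)⟩

theorem Survives.of_prefix {p : Skeleton A} {U : Set ℕ} {H : Set (List ℕ)} {t t' : List ℕ}
    (h : p.Survives U H t') (htt' : t <+: t') : p.Survives U H t := by
  obtain ⟨s, hs, hs', h⟩ := h
  exact ⟨s, hs, htt'.trans hs', h⟩

/-- A skeleton is thin with respect to `U` or has a subskeleton with all successors in `U`. -/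
theorem thin_or_exists_sub (p : Skeleton A) (U : Set ℕ) :
    p.Thin U ∨ ∃ q : Skeleton A, q.Sub p ∧ ∀ t ∈ q.nodes, q.succ t ⊆ U := by
  classical
  by_cases hall : ∀ t ∈ p.nodes, ∃ α, ¬ p.Survives U (p.derivative U α) t
  · left
    -- The rank is the last stage of the derivative to which the node belongs.
    let r : List ℕ → Ordinal.{0} := fun t => sInf {α | ¬ p.Survives U (p.derivative U α) t}
    have hr : ∀ t ∈ p.nodes, ¬ p.Survives U (p.derivative U (r t)) t := fun t ht =>
      csInf_mem (s := {α | ¬ p.Survives U (p.derivative U α) t}) (hall t ht)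
    have hmem : ∀ t ∈ p.nodes, t ∈ p.derivative U (r t) := by
      intro t ht
      rw [mem_derivative]
      refine ⟨ht, fun β hβ => ?_⟩
      by_contra hcon
      exact absurd (csInf_le' (s := {α | ¬ p.Survives U (p.derivative U α) t}) hcon)
        (not_le.2 hβ)
    have hmono : ∀ t ∈ p.nodes, ∀ t' ∈ p.nodes, t <+: t' → r t' ≤ r t := by
      intro t ht t' ht' htt'
      exact csInf_le' (s := {α | ¬ p.Survives U (p.derivative U α) t'})
        fun h => hr t ht (h.of_prefix htt')
    refine ⟨r, fun t => {n | n ∈ p.succ t ∧ n ∈ U ∧ ∃ s ∈ p.derivative U (r t), t ++ [n] <+: s},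
      hmono, ?_, ?_⟩
    · intro t ht
      by_contra hcon
      exact hr t ht ⟨t, ht, List.prefix_rfl, hcon⟩
    · intro t ht n hn hU hN t' ht' hpre
      refine lt_of_le_of_ne (hmono t ht t' ht' ((List.prefix_append _ _).trans hpre)) ?_
      intro heq
      exact hN ⟨hn, hU, t', heq ▸ hmem t' ht', hpre⟩
  · right
    push Not at hall
    obtain ⟨t₀, ht₀, hsurv⟩ := hall
    have hst : ∃ α, ∀ t ∈ p.derivative U α, ∀ β, t ∈ p.derivative U β := by
      have : ∀ t : List ℕ, ∃ α, t ∈ p.derivative U α → ∀ β, t ∈ p.derivative U β := by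
        intro t
        by_cases h : ∀ β, t ∈ p.derivative U β
        · exact ⟨0, fun _ => h⟩
        · push Not at h
          obtain ⟨β, hβ⟩ := h
          exact ⟨β, fun h' => absurd h' hβ⟩
      choose α hα using this
      -- At this stage every sequence that ever leaves the derivative has left it, so the derivative
      -- is stable.
      refine ⟨⨆ t, α t, fun t ht => hα t (derivative_anti (Ordinal.le_iSup α t) ht)⟩
    obtain ⟨α, hα⟩ := hst
    set G := p.derivative U α with hG
    have hGs : ∀ t ∈ G, p.Survives U G t := by
      intro t ht
      have := hα t ht (Order.succ α)
      rw [mem_derivative] at this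
      exact this.2 α (Order.lt_succ α)
    have hGp : ∀ t ∈ p.nodes, ∀ s ∈ G, t <+: s → t ∈ G := by
      intro t ht s hs hts
      rw [hG, mem_derivative] at hs ⊢
      exact ⟨ht, fun β hβ => (hs.2 β hβ).of_prefix hts⟩
    let Y : List ℕ → Set ℕ := fun t => {n | n ∈ p.succ t ∧ n ∈ U ∧ ∃ s ∈ G, t ++ [n] <+: s}
    have hnext : ∀ t, p.Survives U G t → ∃ t' ∈ {t | t ∈ p.nodes ∧ Y t ∉ generatedIdeal A},
        t <+: t' := by
      rintro t ⟨t', ht', htt', h⟩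
      exact ⟨t', ⟨ht', h⟩, htt'⟩
    refine ⟨⟨{t | t ∈ p.nodes ∧ Y t ∉ generatedIdeal A}, Y, ?_, fun t ht => ht.2, ?_⟩, ?_, ?_⟩
    · obtain ⟨t', ht', -⟩ := hnext t₀ (hsurv α)
      exact ⟨t', ht'⟩
    · rintro t ht n ⟨hn, hU, s, hs, hts⟩
      obtain ⟨t', ht', hst'⟩ := hnext s (hGs s hs)
      exact ⟨t', ht', hts.trans hst'⟩
    · exact ⟨fun t ht => ht.1, fun t ht n hn => hn.1⟩
    · exact fun t ht n hn => hn.2.1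

theorem thin_of_succ_subset_compl {p : Skeleton A} {U : Set ℕ}
    (h : ∀ t ∈ p.nodes, p.succ t ⊆ Uᶜ) : p.Thin U :=
  ⟨fun _ => 0, fun _ => ∅, fun _ _ _ _ _ => le_rfl,
    fun _ _ => finite_mem_generatedIdeal finite_empty,
    fun t ht _ hn hU => absurd hU (h t ht hn)⟩

/-- Along a branch through a thin skeleton the successors in `U` eventually are in the small
sets. -/
theorem ThinBy.eventually_mem {p : Skeleton A} {U : Set ℕ} {r : List ℕ → Ordinal.{0}}
    {N : List ℕ → Set ℕ} (h : p.ThinBy U r N) {t : ℕ → List ℕ} {n : ℕ → ℕ} {k₀ : ℕ}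
    (ht : ∀ k, k₀ ≤ k → t k ∈ p.nodes) (hn : ∀ k, k₀ ≤ k → n k ∈ p.succ (t k))
    (htn : ∀ k, t k ++ [n k] <+: t (k + 1)) :
    ∀ᶠ k in atTop, n k ∈ U → n k ∈ N (t k) := by
  -- Ranks do not increase along the branch, so they are constant from a minimum on; a successor in
  -- `U` outside the small set would lower them.
  obtain ⟨_, ⟨k₁, hk₁, rfl⟩, hmin⟩ :=
    (wellFounded_lt (α := Ordinal.{0})).has_min ((fun k => r (t k)) '' Ici k₀)
      ⟨_, k₀, mem_Ici.2 le_rfl, rfl⟩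
  have hle : ∀ k, k₁ ≤ k → r (t k) = r (t k₁) := by
    intro k hk
    induction k, hk using Nat.le_induction with
    | base => rfl
    | succ k hk ih =>
      have hk₀ : k₀ ≤ k := le_trans hk₁ hk
      refine le_antisymm ?_ (not_lt.1 (hmin _ ⟨k + 1, by simp only [mem_Ici]; omega, rfl⟩))
      rw [← ih]
      exact h.1 _ (ht k hk₀) _ (ht (k + 1) (by omega)) ((List.prefix_append _ _).trans (htn k))
  filter_upwards [eventually_ge_atTop k₁] with k hk hU
  have hk₀ : k₀ ≤ k := le_trans hk₁ hk
  by_contra hN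
  have := h.2.2 (t k) (ht k hk₀) (n k) (hn k hk₀) hU hN (t (k + 1)) (ht (k + 1) (by omega)) (htn k)
  rw [hle k hk, hle (k + 1) (by omega)] at this
  exact lt_irrefl _ this

/-- At a node of least rank some successor in `U` avoids the small set, and any node above it would
have smaller rank. -/
theorem not_thin_of_pos {p : Skeleton A} {U : Set ℕ}
    (h : ∀ t ∈ p.nodes, p.succ t ∩ U ∉ generatedIdeal A) : ¬ p.Thin U := by
  rintro ⟨r, N, hr⟩
  obtain ⟨_, ⟨t, ht, rfl⟩, hmin⟩ :=
    (wellFounded_lt (α := Ordinal.{0})).has_min (r '' p.nodes) (p.nonempty.image r)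
  have : ∃ n ∈ p.succ t ∩ U, n ∉ N t := by
    by_contra hcon
    push Not at hcon
    exact h t ht (mem_generatedIdeal_of_subset (hr.2.1 t ht) hcon)
  obtain ⟨n, ⟨hn, hU⟩, hN⟩ := this
  obtain ⟨t', ht', htt'⟩ := p.ext t ht n hn
  exact hmin _ ⟨t', ht', rfl⟩ (hr.2.2 t ht n hn hU hN t' ht' htt')

theorem exists_bound_of_denumerable {K α : Type} [Denumerable α]
    (hb : ∀ h : K → ℕ → ℕ, ∃ H : ℕ → ℕ, ∀ b, ∀ᶠ n in atTop, h b n ≤ H n) (h : K → α → ℕ) :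
    ∃ H : α → ℕ, ∀ b, ∀ᶠ a in cofinite, h b a ≤ H a := by
  obtain ⟨H, hH⟩ := hb fun b n => h b ((Denumerable.eqv α).symm n)
  refine ⟨fun a => H (Denumerable.eqv α a), fun b => ?_⟩
  have := (Denumerable.eqv α).injective.tendsto_cofinite.eventually
    (Nat.cofinite_eq_atTop ▸ hH b)
  simpa using this

/-- Every skeleton has a member of a strongly splitting family neither side of which is thin. -/
theorem exists_not_thin (hA : IsAD A) {K : Type} {S : K → Set ℕ} (hS : IsStronglySplitting S)
    (p : Skeleton A) : ∃ b, ¬ p.Thin (S b) ∧ ¬ p.Thin (S b)ᶜ := by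
  have hseq : ∀ t, ∃ Y : ℕ → Set ℕ, (∀ m, (Y m).Infinite) ∧ (t ∈ p.nodes → (∀ m, Y m ⊆ p.succ t) ∧
      ∀ W : Set ℕ, {m | (W ∩ Y m).Infinite}.Infinite → W ∉ generatedIdeal A) := by
    intro t
    by_cases ht : t ∈ p.nodes
    · obtain ⟨Y, h1, h2, h3⟩ := exists_seq_of_notMem_generatedIdeal hA (p.pos t ht)
      exact ⟨Y, h1, fun _ => ⟨h2, h3⟩⟩
    · exact ⟨fun _ => univ, fun _ => infinite_univ, fun h => absurd h ht⟩
  choose Y hYinf hY using hseq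
  rcases hS with hS | ⟨hS, hb⟩
  -- One `S b` splits the witnesses of positivity of all successor sets at once, so both sides stay
  -- positive at every node.
  · obtain ⟨b, hb⟩ := hS
      (fun k => Y (Denumerable.ofNat (List ℕ × ℕ) k).1 (Denumerable.ofNat (List ℕ × ℕ) k).2)
      fun k => hYinf _ _
    have hb' : ∀ t m, Splits (S b) (Y t m) := fun t m => by
      have := hb (Encodable.encode (t, m))
      simpa using this
    refine ⟨b, not_thin_of_pos fun t ht => (hY t ht).2 _ ?_, not_thin_of_pos fun t ht =>
      (hY t ht).2 _ ?_⟩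
    · refine infinite_univ.mono fun m _ => (hb' t m).1.mono ?_
      exact fun x hx => ⟨⟨(hY t ht).1 m hx.2, hx.1⟩, hx.2⟩
    · refine infinite_univ.mono fun m _ => (hb' t m).2.mono ?_
      exact fun x hx => ⟨⟨(hY t ht).1 m hx.1, hx.2⟩, hx.1⟩
  · by_contra hcon
    -- Suppose each `b` has a thin side `U b`. Bounding the functions that locate the small sets `N
    -- b t` produces one branch whose values are almost disjoint from every `U b`, so that no `S b`
    -- splits them.
    have hdec : ∀ b, ∃ U, (U = S b ∨ U = (S b)ᶜ) ∧ p.Thin U := by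
      intro b
      by_contra h
      push Not at h
      exact hcon ⟨b, h _ (Or.inl rfl), h _ (Or.inr rfl)⟩
    choose U hU r N hthin using hdec
    have h1 : ∀ b t, ∃ m₀, t ∈ p.nodes → ∀ m, m₀ ≤ m → (N b t ∩ Y t m).Finite := by
      intro b t
      by_cases ht : t ∈ p.nodes
      · have hfin : {m | (N b t ∩ Y t m).Infinite}.Finite := by
          by_contra h
          exact (hY t ht).2 _ h ((hthin b).2.1 t ht)
        obtain ⟨m₀, hm₀⟩ := hfin.bddAbove
        refine ⟨m₀ + 1, fun _ m hm => ?_⟩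
        by_contra h
        have := hm₀ h
        omega
      · exact ⟨0, fun h => absurd h ht⟩
    choose h₁ hh₁ using h1
    have h2 : ∀ b (a : List ℕ × ℕ), ∃ c, (N b a.1 ∩ Y a.1 a.2).Finite →
        ∀ n ∈ N b a.1 ∩ Y a.1 a.2, n ≤ c := by
      intro b a
      by_cases ha : (N b a.1 ∩ Y a.1 a.2).Finite
      · obtain ⟨c, hc⟩ := ha.bddAbove
        exact ⟨c, fun _ n hn => hc hn⟩
      · exact ⟨0, fun h => absurd h ha⟩
    choose h₂ hh₂ using h2
    obtain ⟨H₁, hH₁⟩ := exists_bound_of_denumerable hb h₁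
    obtain ⟨H₂, hH₂⟩ := exists_bound_of_denumerable hb h₂
    -- Exceeding `t.sum` makes the values increase along the branch, since each value is an entry of
    -- the next node; exceeding `H₂` avoids `N b t` for all but finitely many `t`, for each `b`.
    choose n hnY hn using fun t => (hYinf t (H₁ t)).exists_gt (max t.sum (H₂ (t, H₁ t)))
    have hstep : ∀ t : p.nodes, ∃ t' : p.nodes, t.1 ++ [n t.1] <+: t'.1 := by
      rintro ⟨t, ht⟩
      obtain ⟨t', ht', h⟩ := p.ext t ht (n t) ((hY t ht).1 _ (hnY t))
      exact ⟨⟨t', ht'⟩, h⟩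
    choose next hnext using hstep
    obtain ⟨t₀, ht₀⟩ := p.nonempty
    let T : ℕ → p.nodes := fun k => next^[k] ⟨t₀, ht₀⟩
    let t : ℕ → List ℕ := fun k => (T k).1
    have htn : ∀ k, t k ++ [n (t k)] <+: t (k + 1) := by
      intro k
      have : T (k + 1) = next (T k) := Function.iterate_succ_apply' _ _ _
      change (T k).1 ++ [n (T k).1] <+: (T (k + 1)).1
      rw [this]
      exact hnext (T k)
    have htinj : Function.Injective t := by
      refine Function.Injective.of_comp (f := List.length) (StrictMono.injective ?_)
      refine strictMono_nat_of_lt_succ fun k => ?_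
      have := (htn k).length_le
      simp only [List.length_append, List.length_singleton] at this
      simpa using this
    have hnmono : StrictMono fun k => n (t k) := by
      refine strictMono_nat_of_lt_succ fun k => ?_
      have h1 : n (t k) ∈ t (k + 1) := (htn k).subset (by simp)
      have h2 := List.le_sum_of_mem h1
      have h3 := hn (t (k + 1))
      exact h2.trans_lt (lt_of_le_of_lt (le_max_left _ _) h3)
    have hfin : ∀ b, (range (fun k => n (t k)) ∩ U b).Finite := by
      intro b
      have e1 := (hthin b).eventually_mem (t := t) (n := fun k => n (t k)) (k₀ := 0)
        (fun k _ => (T k).2) (fun k _ => (hY _ (T k).2).1 _ (hnY _)) htn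
      have e2 : ∀ᶠ k in atTop, h₁ b (t k) ≤ H₁ (t k) := by
        rw [← Nat.cofinite_eq_atTop]
        exact htinj.tendsto_cofinite.eventually (hH₁ b)
      have e3 : ∀ᶠ k in atTop, h₂ b (t k, H₁ (t k)) ≤ H₂ (t k, H₁ (t k)) := by
        rw [← Nat.cofinite_eq_atTop]
        have : Function.Injective fun k => (t k, H₁ (t k)) := fun i j h =>
          htinj (congrArg Prod.fst h)
        exact this.tendsto_cofinite.eventually (hH₂ b)
      obtain ⟨k₀, hk₀⟩ := eventually_atTop.1 (e1.and (e2.and e3))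
      refine ((finite_Iio k₀).image fun k => n (t k)).subset ?_
      rintro _ ⟨⟨k, rfl⟩, hk⟩
      refine ⟨k, ?_, rfl⟩
      by_contra hlt
      obtain ⟨a1, a2, a3⟩ := hk₀ k (not_lt.1 hlt)
      have b1 := hh₁ b (t k) (T k).2 _ a2
      have b2 := hh₂ b (t k, H₁ (t k)) b1 _ ⟨a1 hk, hnY (t k)⟩
      have b3 := hn (t k)
      have b4 := le_max_right (t k).sum (H₂ (t k, H₁ (t k)))
      omega
    obtain ⟨b, hb⟩ := hS _ (infinite_range_of_injective hnmono.injective)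
    rcases hU b with h | h
    · refine hb.1 ?_
      rw [inter_comm, ← h]
      exact hfin b
    · refine hb.2 ?_
      rw [Set.sdiff_eq, ← h]
      exact hfin b

end Skeleton

/-! ### Nodes of positive sets and good families -/

/-- `U` or its complement. -/
def side (U : Set ℕ) (b : Bool) : Set ℕ := {n | n ∈ U ↔ b = true}

@[simp] theorem side_true (U : Set ℕ) : side U true = U := by
  ext n
  simp [side]

@[simp] theorem side_false (U : Set ℕ) : side U false = Uᶜ := by
  ext n
  simp [side]

theorem side_not (U : Set ℕ) (b : Bool) : side U (!b) = (side U b)ᶜ := by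
  cases b <;> simp

/-- Every positive set is split into two positive pieces by a strongly splitting family. -/
theorem exists_positive_split {K : Type} {S : K → Set ℕ} {A : Set (Set ℕ)} (hA : IsAD A) (hS : IsStronglySplitting S)
    {Y : Set ℕ} (hY : Y ∉ generatedIdeal A) :
    ∃ b, ∀ c, Y ∩ side (S b) c ∉ generatedIdeal A := by
  -- All sequences are nodes with successor set `Y`; if `Y ∩ U` is in the ideal, rank `0` and the
  -- small set `Y ∩ U` everywhere witness thinness.
  let p : Skeleton A :=
    { nodes := univ
      succ := fun _ => Y
      nonempty := ⟨[], trivial⟩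
      pos := fun _ _ => hY
      ext := fun t _ n _ => ⟨t ++ [n], trivial, List.prefix_rfl⟩ }
  have key : ∀ U, Y ∩ U ∈ generatedIdeal A → p.Thin U := fun U hU =>
    ⟨fun _ => 0, fun _ => Y ∩ U, fun _ _ _ _ _ => le_rfl, fun _ _ => hU,
      fun _ _ n hn hnU hnN => absurd ⟨hn, hnU⟩ hnN⟩
  obtain ⟨b, h1, h2⟩ := p.exists_not_thin hA hS
  refine ⟨b, fun c hc => ?_⟩
  cases c
  · exact h2 (key _ (by simpa using hc))
  · exact h1 (key _ (by simpa using hc))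

section

variable {K : Type} [LinearOrder K]

/-- The node `σ`, a sequence of length `σ.1`, is an initial segment of `τ`. -/
def NodeLE (σ τ : K × (K → Bool)) : Prop := σ.1 ≤ τ.1 ∧ ∀ b < σ.1, σ.2 b = τ.2 b

theorem NodeLE.refl (σ : K × (K → Bool)) : NodeLE σ σ := ⟨le_rfl, fun _ _ => rfl⟩

theorem NodeLE.trans {σ τ υ : K × (K → Bool)} (h : NodeLE σ τ) (h' : NodeLE τ υ) : NodeLE σ υ :=
  ⟨h.1.trans h'.1, fun b hb => (h.2 b hb).trans (h'.2 b (hb.trans_le h.1))⟩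

theorem nodeLE_or (σ τ : K × (K → Bool)) :
    NodeLE σ τ ∨ NodeLE τ σ ∨ ∃ b < σ.1, b < τ.1 ∧ σ.2 b ≠ τ.2 b := by
  by_cases h : ∃ b < σ.1, b < τ.1 ∧ σ.2 b ≠ τ.2 b
  · exact Or.inr (Or.inr h)
  · push Not at h
    rcases le_total σ.1 τ.1 with hle | hle
    · exact Or.inl ⟨hle, fun b hb => h b hb (hb.trans_le hle)⟩
    · exact Or.inr (Or.inl ⟨hle, fun b hb => (h b (hb.trans_le hle) hb).symm⟩)

/-- An almost disjoint family of members of `I`, with different nodes attached to its members such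
that the node of `X` records which sides of the sets `S b` almost contain `X`. -/
structure IsGood (S : K → Set ℕ) (I : Set (Set ℕ)) (G : Set (Set ℕ × (K × (K → Bool)))) :
    Prop where
  infinite : ∀ x ∈ G, x.1.Infinite
  mem : ∀ x ∈ G, x.1 ∈ I
  almost : ∀ x ∈ G, ∀ b < x.2.1, (x.1 \ side (S b) (x.2.2 b)).Finite
  ad : ∀ x ∈ G, ∀ y ∈ G, x ≠ y → (x.1 ∩ y.1).Finite
  nodes : ∀ x ∈ G, ∀ y ∈ G, x ≠ y → ¬ (NodeLE x.2 y.2 ∧ NodeLE y.2 x.2)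

variable {S : K → Set ℕ} {I : Set (Set ℕ)} {G : Set (Set ℕ × (K × (K → Bool)))}

theorem IsGood.isAD (hG : IsGood S I G) : IsAD (Prod.fst '' G) := by
  refine ⟨?_, ?_⟩
  · rintro _ ⟨x, hx, rfl⟩
    exact hG.infinite x hx
  · rintro _ ⟨x, hx, rfl⟩ _ ⟨y, hy, rfl⟩ hne
    exact hG.ad x hx y hy fun h => hne (h ▸ rfl)

theorem IsGood.injOn_fst (hG : IsGood S I G) : InjOn Prod.fst G := by
  intro x hx y hy h
  by_contra hne
  have := hG.ad x hx y hy hne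
  rw [h, inter_self] at this
  exact hG.infinite y hy this

theorem mk_iUnion_lt {κ : Cardinal.{0}} (hκ : Cardinal.aleph0 ≤ κ) {ι α : Type}
    (hι : Cardinal.mk ι < κ) {F : ι → Set α} (hF : ∀ i, (F i).Finite) :
    Cardinal.mk (⋃ i, F i) < κ := by
  rcases finite_or_infinite ι with h | h
  · exact (Cardinal.lt_aleph0_iff_set_finite.2 (finite_iUnion hF)).trans_le hκ
  · refine lt_of_le_of_lt (Cardinal.mk_iUnion_le F) ?_
    have h1 : ⨆ i, Cardinal.mk (F i) ≤ Cardinal.aleph0 :=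
      ciSup_le' fun i => (Cardinal.lt_aleph0_iff_set_finite.2 (hF i)).le
    have h2 := Cardinal.aleph0_le_mk ι
    exact lt_of_le_of_lt (mul_le_mul' le_rfl h1) (by rwa [Cardinal.mul_aleph0_eq h2])

/-- Initial segments of `ν` are determined by their length, and different members have different
nodes. -/
theorem IsGood.mk_nodeLE_lt (hG : IsGood S I G) [NoMaxOrder K] {κ : Cardinal.{0}}
    (hK : ∀ b : K, Cardinal.mk (Iio b) < κ) (ν : K × (K → Bool)) :
    Cardinal.mk {x ∈ G | NodeLE x.2 ν} < κ := by
  obtain ⟨c, hc⟩ := exists_gt ν.1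
  refine lt_of_le_of_lt ?_ (hK c)
  refine Cardinal.mk_le_of_injective
    (f := fun x : {x ∈ G | NodeLE x.2 ν} => (⟨x.1.2.1, x.2.2.1.trans_lt hc⟩ : Iio c)) ?_
  rintro ⟨x, hx, hxν⟩ ⟨y, hy, hyν⟩ h
  replace h : x.2.1 = y.2.1 := congrArg Subtype.val h
  refine Subtype.ext ?_
  by_contra hne
  refine hG.nodes x hx y hy hne ⟨⟨h.le, fun b hb => ?_⟩, ⟨h.ge, fun b hb => ?_⟩⟩
  · rw [hxν.2 b hb, hyν.2 b (h ▸ hb)]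
  · rw [hxν.2 b (h ▸ hb), hyν.2 b hb]

/-- Below a positive set there is an infinite set almost disjoint from all members with a node
below `ν`, and from fewer than `𝔞` small sets. -/
theorem IsGood.exists_almostDisjoint (hG : IsGood S I G) [NoMaxOrder K]
    {κ : Cardinal.{0}} (hκ : Cardinal.aleph0 ≤ κ) (hK : ∀ b : K, Cardinal.mk (Iio b) < κ)
    (hκa : κ ≤ almostDisjointnessNumber) (ν : K × (K → Bool)) {N : K → Set ℕ}
    (hN : ∀ b < ν.1, N b ∈ generatedIdeal (Prod.fst '' G)) {Y : Set ℕ}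
    (hY : Y ∉ generatedIdeal (Prod.fst '' G)) :
    ∃ Z ⊆ Y, Z.Infinite ∧ (∀ x ∈ G, NodeLE x.2 ν → (Z ∩ x.1).Finite) ∧
      ∀ b < ν.1, (Z ∩ N b).Finite := by
  choose! F hF hFG hFN using hN
  set B : Set (Set ℕ) := Prod.fst '' {x ∈ G | NodeLE x.2 ν} ∪ ⋃ b : Iio ν.1, F b with hB
  have hBG : B ⊆ Prod.fst '' G :=
    union_subset (image_mono fun x hx => hx.1) (iUnion_subset fun b => hFG b.1 b.2)
  have hsmall : Cardinal.mk B < almostDisjointnessNumber := by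
    refine lt_of_lt_of_le ?_ hκa
    refine lt_of_le_of_lt (Cardinal.mk_union_le _ _) (Cardinal.add_lt_of_lt hκ ?_ ?_)
    · exact lt_of_le_of_lt Cardinal.mk_image_le (hG.mk_nodeLE_lt hK ν)
    · exact mk_iUnion_lt hκ (hK ν.1) fun b => hF b.1 b.2
  obtain ⟨Z, hZY, hZ, hZB⟩ := exists_infinite_subset_almostDisjoint hG.isAD hBG hsmall hY
  refine ⟨Z, hZY, hZ, fun x hx hxν => hZB _ (Or.inl ⟨x, ⟨hx, hxν⟩, rfl⟩), fun b hb => ?_⟩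
  exact finite_inter_of_cover (hF b hb) (hFN b hb) fun B hB =>
    hZB B (Or.inr (mem_iUnion.2 ⟨⟨b, hb⟩, hB⟩))

/-- `ν` is the sequence of those decisions about the sides of the sets `S b` that the positive set
`Y` makes up to the first `S b` that splits it into positive pieces. -/
def IsNodeOf (S : K → Set ℕ) (A : Set (Set ℕ)) (Y : Set ℕ) (ν : K × (K → Bool)) : Prop :=
  (∀ b < ν.1, Y ∩ side (S b) (!ν.2 b) ∈ generatedIdeal A) ∧
    ∀ c, Y ∩ side (S ν.1) c ∉ generatedIdeal A

theorem exists_isNodeOf [WellFoundedLT K] {A : Set (Set ℕ)} (hA : IsAD A)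
    (hS : IsStronglySplitting S) {Y : Set ℕ} (hY : Y ∉ generatedIdeal A) :
    ∃ ν, IsNodeOf S A Y ν := by
  obtain ⟨b, hb, hmin⟩ := (wellFounded_lt (α := K)).has_min
    {b | ∀ c, Y ∩ side (S b) c ∉ generatedIdeal A} (exists_positive_split hA hS hY)
  have : ∀ a, ∃ c : Bool, a < b → Y ∩ side (S a) (!c) ∈ generatedIdeal A := by
    intro a
    by_cases ha : a < b
    · have : ¬ ∀ c, Y ∩ side (S a) c ∉ generatedIdeal A := fun h => hmin a h ha
      push Not at this
      obtain ⟨c, hc⟩ := this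
      exact ⟨!c, fun _ => by simpa using hc⟩
    · exact ⟨true, fun h => absurd h ha⟩
  choose η hη using this
  exact ⟨(b, η), hη, hb⟩

/-- A node ending at or before `b` would end at a set whose two sides are both positive on `Y`,
although `η` decides it; and opposite decisions at `b` would put `Y` itself into the ideal. -/
theorem IsNodeOf.eq_of_decided {A : Set (Set ℕ)} {Y : Set ℕ} {ν : K × (K → Bool)}
    (hν : IsNodeOf S A Y ν) (hY : Y ∉ generatedIdeal A) {b : K} {η : K → Bool}
    (h : ∀ a ≤ b, Y ∩ side (S a) (!η a) ∈ generatedIdeal A) : b < ν.1 ∧ ν.2 b = η b := by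
  have hb : b < ν.1 := by
    by_contra hle
    exact hν.2 _ (h ν.1 (not_lt.1 hle))
  refine ⟨hb, ?_⟩
  by_contra hne
  have h1 := hν.1 b hb
  have h2 := h b le_rfl
  have h3 : (!ν.2 b) = η b := by
    revert hne
    cases ν.2 b <;> cases η b <;> simp
  rw [h3] at h1
  refine hY (mem_generatedIdeal_of_subset (union_mem_generatedIdeal h1 h2) ?_)
  rw [side_not, ← inter_union_distrib_left, union_compl_self, inter_univ]

/-- There are continuum many positive subsets of a positive set with incompatible nodes. -/
theorem exists_incompatible_nodes [WellFoundedLT K] {A : Set (Set ℕ)} (hA : IsAD A)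
    (hS : IsStronglySplitting S) {X : Set ℕ} (hX : X ∉ generatedIdeal A) :
    ∃ (Z : (ℕ → Bool) → Set ℕ) (ν : (ℕ → Bool) → K × (K → Bool)),
      (∀ x, Z x ∉ generatedIdeal A ∧ Z x ⊆ X ∧ IsNodeOf S A (Z x) (ν x)) ∧
      ∀ x y, x ≠ y → ∃ b < (ν x).1, b < (ν y).1 ∧ (ν x).2 b ≠ (ν y).2 b := by
  choose node hnode using fun Y : {Y : Set ℕ // Y ∉ generatedIdeal A} =>
    exists_isNodeOf hA hS Y.2
  -- A Cantor scheme: step `k` passes to the side `x k` of the first set that splits the current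
  -- positive set into positive pieces.
  let Y : (ℕ → Bool) → ℕ → {Y : Set ℕ // Y ∉ generatedIdeal A} := fun x k =>
    Nat.rec ⟨X, hX⟩ (fun k Y => ⟨Y.1 ∩ side (S (node Y).1) (x k), (hnode Y).2 _⟩) k
  have hYsucc : ∀ x k, (Y x (k + 1)).1 = (Y x k).1 ∩ side (S (node (Y x k)).1) (x k) :=
    fun _ _ => rfl
  have hanti : ∀ x, Antitone fun k => (Y x k).1 := fun x =>
    antitone_nat_of_succ_le fun k => by
      rw [hYsucc]
      exact inter_subset_left
  choose Z hZ hZX hZY using fun x => exists_pseudointersection hA (fun k => (Y x k).2) (hanti x)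
  have hdec : ∀ x k, (node (Y x k)).1 < (node ⟨Z x, hZ x⟩).1 ∧
      (node ⟨Z x, hZ x⟩).2 (node (Y x k)).1 = x k := by
    intro x k
    have := (hnode ⟨Z x, hZ x⟩).eq_of_decided (hZ x) (b := (node (Y x k)).1)
      (η := fun a => if a < (node (Y x k)).1 then (node (Y x k)).2 a else x k) ?_
    · simpa using this
    · intro a ha
      rcases ha.lt_or_eq with ha | rfl
      · refine mem_generatedIdeal_of_sdiff_finite ((hnode (Y x k)).1 a ha) ?_
        refine (hZY x k).subset ?_
        simp only [ha, if_true]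
        rintro n ⟨⟨hn, hns⟩, hn'⟩
        exact ⟨hn, fun h => hn' ⟨h, hns⟩⟩
      · refine finite_mem_generatedIdeal ((hZY x (k + 1)).subset ?_)
        simp only [lt_irrefl, if_false]
        rintro n ⟨hn, hns⟩
        refine ⟨hn, fun h => ?_⟩
        rw [hYsucc] at h
        rw [side_not] at hns
        exact hns h.2
  refine ⟨Z, fun x => node ⟨Z x, hZ x⟩, fun x => ⟨hZ x, hZX x, hnode _⟩, fun x y hxy => ?_⟩
  classical
  have hex : ∃ k, x k ≠ y k := Function.ne_iff.1 hxy
  let k := Nat.find hex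
  have hlt : ∀ i < k, x i = y i := fun i hi => not_not.1 (Nat.find_min hex hi)
  have hYk : ∀ i ≤ k, Y x i = Y y i := by
    intro i hi
    induction i with
    | zero => rfl
    | succ i ih =>
      have h1 := ih (by omega)
      apply Subtype.ext
      rw [hYsucc, hYsucc, h1, hlt i (by omega)]
  have h1 := hdec x k
  have h2 := hdec y k
  rw [← hYk k le_rfl] at h2
  refine ⟨_, h1.1, h2.1, ?_⟩
  rw [h1.2, h2.2]
  exact Nat.find_spec hex

/-- A good family of size less than the continuum can be extended by infinitely many subsets of a
given positive set. -/
theorem IsGood.exists_extension {J : Order.Ideal (Set ℕ)} (hG : IsGood S J G) (hJ : IsTall J)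
    [WellFoundedLT K] [NoMaxOrder K]
    {κ : Cardinal.{0}} (hκ : Cardinal.aleph0 ≤ κ) (hK : ∀ b : K, Cardinal.mk (Iio b) < κ)
    (hκa : κ ≤ almostDisjointnessNumber) (hS : IsStronglySplitting S)
    (hcard : Cardinal.mk G < Cardinal.continuum) {X : Set ℕ}
    (hX : X ∉ generatedIdeal (Prod.fst '' G)) :
    ∃ N : Set (Set ℕ × (K × (K → Bool))), N.Countable ∧ N.Infinite ∧ IsGood S J (G ∪ N) ∧
      ∀ y ∈ N, y.1 ⊆ X := by
  obtain ⟨Y, ν, hY, hν⟩ := exists_incompatible_nodes hG.isAD hS hX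
  set D : Set (ℕ → Bool) := {x | ∀ y ∈ G, ¬ NodeLE (ν x) y.2} with hD
  have hinf : D.Infinite := by
    intro hfin
    -- A member of `G` has its node above at most one of the incompatible nodes, so only few of them
    -- are spoilt.
    have hbad : Cardinal.mk (Dᶜ : Set (ℕ → Bool)) ≤ Cardinal.mk G := by
      have : ∀ x : (Dᶜ : Set (ℕ → Bool)), ∃ y : G, NodeLE (ν x) y.1.2 := by
        rintro ⟨x, hx⟩
        by_contra hcon
        push Not at hcon
        exact hx fun y hy => hcon ⟨y, hy⟩
      choose Φ hΦ using this
      refine Cardinal.mk_le_of_injective (f := Φ) fun x x' h => ?_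
      by_contra hne
      obtain ⟨b, hb, hb', hbne⟩ := hν x.1 x'.1 fun h => hne (Subtype.ext h)
      refine hbne ?_
      rw [(hΦ x).2 b hb, (hΦ x').2 b hb', h]
    have h1 := Cardinal.mk_sum_compl D
    have h2 : Cardinal.mk (ℕ → Bool) = Cardinal.continuum := by simp
    rw [h2] at h1
    refine absurd h1.ge (not_le.2 (Cardinal.add_lt_of_lt Cardinal.aleph0_le_continuum ?_ ?_))
    · exact (Cardinal.lt_aleph0_iff_set_finite.2 hfin).trans Cardinal.aleph0_lt_continuum
    · exact hbad.trans_lt hcard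
  let e := hinf.natEmbedding
  have hex : ∀ i, ∃ Z ⊆ X, Z.Infinite ∧ Z ∈ J ∧ (∀ y ∈ G, NodeLE y.2 (ν (e i)) → (Z ∩ y.1).Finite) ∧
      ∀ b < (ν (e i)).1, (Z \ side (S b) ((ν (e i)).2 b)).Finite := by
    intro i
    obtain ⟨h1, h2, h3⟩ := hY (e i)
    obtain ⟨Z, hZY, hZ, hZG, hZN⟩ := hG.exists_almostDisjoint hκ hK hκa (ν (e i)) h3.1 h1
    -- Tallness brings the new set into the ideal `J`.
    obtain ⟨W, hW, hZW⟩ := hJ Z hZ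
    refine ⟨Z ∩ W, (inter_subset_left.trans hZY).trans h2, hZW,
      J.lower inter_subset_right hW, fun y hy hyν => ?_, fun b hb => ?_⟩
    · exact (hZG y hy hyν).subset (inter_subset_inter_left _ inter_subset_left)
    · refine (hZN b hb).subset ?_
      rintro n ⟨⟨hn, -⟩, hns⟩
      rw [side_not]
      exact ⟨hn, hZY hn, hns⟩
  choose Z hZX hZ hZJ hZG hZN using hex
  have disj : ∀ (U V : Set ℕ) (b : K) (c d : Bool), c ≠ d → (U \ side (S b) c).Finite →
      (V \ side (S b) d).Finite → (U ∩ V).Finite := by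
    intro U V b c d hcd hU hV
    refine (hU.union hV).subset ?_
    rintro n ⟨hnU, hnV⟩
    by_cases h : n ∈ side (S b) c
    · refine Or.inr ⟨hnV, fun h' => ?_⟩
      have hd : d = !c := by
        revert hcd
        cases c <;> cases d <;> simp
      rw [hd, side_not] at h'
      exact h' h
    · exact Or.inl ⟨hnU, h⟩
  -- An old node above the new one is excluded by `D`, one below was taken care of in choosing `Z
  -- i`, and an incompatible one puts the two sets on opposite sides of some `S b`.
  have hold : ∀ y ∈ G, ∀ i, (y.1 ∩ Z i).Finite := by
    intro y hy i
    rcases nodeLE_or (ν (e i)) y.2 with h | h | ⟨b, hb, hb', hne⟩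
    · exact absurd h ((e i).2 y hy)
    · rw [inter_comm]
      exact hZG i y hy h
    · exact disj _ _ b _ _ hne.symm (hG.almost y hy b hb') (hZN i b hb)
  have hincomp : ∀ i j, i ≠ j → ∃ b < (ν (e i)).1, b < (ν (e j)).1 ∧
      (ν (e i)).2 b ≠ (ν (e j)).2 b := fun i j hij =>
    hν _ _ fun h => hij (e.injective (Subtype.ext h))
  have hnew : ∀ i j, i ≠ j → (Z i ∩ Z j).Finite := by
    intro i j hij
    obtain ⟨b, hb, hb', hne⟩ := hincomp i j hij
    exact disj _ _ b _ _ hne (hZN i b hb) (hZN j b hb')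
  refine ⟨range fun i => (Z i, ν (e i)), countable_range _, ?_, ?_, ?_⟩
  · refine infinite_range_of_injective fun i j h => ?_
    by_contra hij
    obtain ⟨b, -, -, hne⟩ := hincomp i j hij
    exact hne (by rw [(Prod.mk.inj h).2])
  · refine ⟨?_, ?_, ?_, ?_, ?_⟩
    · rintro _ (hx | ⟨i, rfl⟩)
      exacts [hG.infinite _ hx, hZ i]
    · rintro _ (hx | ⟨i, rfl⟩)
      exacts [hG.mem _ hx, hZJ i]
    · rintro _ (hx | ⟨i, rfl⟩)
      exacts [hG.almost _ hx, hZN i]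
    · rintro x (hx | ⟨i, rfl⟩) y (hy | ⟨j, rfl⟩) hne
      · exact hG.ad x hx y hy hne
      · exact hold x hx j
      · rw [inter_comm]
        exact hold y hy i
      · exact hnew i j fun h => hne (by rw [h])
    · rintro x (hx | ⟨i, rfl⟩) y (hy | ⟨j, rfl⟩) hne
      · exact hG.nodes x hx y hy hne
      · exact fun h => (e j).2 x hx h.2
      · exact fun h => (e i).2 y hy h.1
      · rintro ⟨h, -⟩
        obtain ⟨b, hb, -, hne'⟩ := hincomp i j fun h => hne (by rw [h])
        exact hne' (h.2 b hb)
  · rintro _ ⟨i, rfl⟩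
    exact hZX i

end

/-! ### Branches with positive range -/

theorem mk_finset_lt {κ : Cardinal.{0}} (hκ : Cardinal.aleph0 ≤ κ) {α : Type}
    (h : Cardinal.mk α < κ) : Cardinal.mk (Finset α) < κ := by
  rcases finite_or_infinite α with hα | hα
  · exact (Cardinal.lt_aleph0_of_finite _).trans_le hκ
  · rwa [Cardinal.mk_finset_of_infinite]

/-- There are only finitely many short sequences with small entries. -/
theorem finite_short_lists (m : ℕ) :
    {w : List (Bool × ℕ) | w.length ≤ m ∧ ∀ e ∈ w, e.2 ≤ m}.Finite := by
  refine ((List.finite_length_le (Bool × Fin (m + 1)) m).image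
    (List.map (Prod.map id Fin.val))).subset ?_
  rintro w ⟨hw, hm⟩
  refine ⟨w.map (Prod.map id (Fin.ofNat (m + 1))), by simpa using hw, ?_⟩
  rw [List.map_map]
  refine (List.map_congr_left fun e he => ?_).trans (List.map_id w)
  have := hm e he
  refine Prod.ext rfl ?_
  exact Nat.mod_eq_of_lt (Nat.lt_succ_of_le this)

/-- An increasing chain of nodes of a tree determines a branch. -/
theorem exists_branch_of_chain {T : Descriptive.tree ℕ} {t : ℕ → List ℕ} {n : ℕ → ℕ}
    (ht : ∀ k, t k ∈ T) (htn : ∀ k, t k ++ [n k] <+: t (k + 1)) :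
    ∃ f ∈ branches T, ∀ k, n k ∈ range f := by
  have hmono : ∀ j k, j ≤ k → t j <+: t k := by
    intro j k hjk
    induction k, hjk using Nat.le_induction with
    | base => exact List.prefix_rfl
    | succ k _ ih => exact ih.trans ((List.prefix_append _ _).trans (htn k))
  have hlen : ∀ k, k ≤ (t k).length := by
    intro k
    induction k with
    | zero => exact Nat.zero_le _
    | succ k ih =>
      have := (htn k).length_le
      simp only [List.length_append, List.length_singleton] at this
      omega
  let f : ℕ → ℕ := fun i => (t (i + 1)).getD i 0
  have hget : ∀ k i, ∀ h : i < (t k).length, (t k)[i] = f i := by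
    intro k i h
    have hi : i < (t (i + 1)).length := hlen (i + 1)
    have hf : f i = (t (i + 1))[i] := List.getD_eq_getElem _ _ hi
    rw [hf]
    rcases le_total k (i + 1) with hle | hle
    · exact (hmono _ _ hle).getElem h
    · exact ((hmono _ _ hle).getElem hi).symm
  refine ⟨f, fun k => ?_, fun k => ⟨(t k).length, ?_⟩⟩
  · refine Descriptive.Tree.mem_of_prefix (y := t k) ?_ (ht k)
    rw [List.prefix_iff_eq_take]
    refine List.ext_getElem (by simpa using hlen k) fun i h1 h2 => ?_
    simp only [List.length_map, List.length_range] at h1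
    simp only [List.getElem_map, List.getElem_range, List.getElem_take]
    rw [hget]
  · have h1 := (htn k).length_le
    simp only [List.length_append, List.length_singleton] at h1
    rw [← hget (k + 1) (t k).length (by omega),
      ← (htn k).getElem (show (t k).length < (t k ++ [n k]).length by simp)]
    simp

section

variable {K : Type} [LinearOrder K]

/-- A skeleton with witnesses that it is thin with respect to the sides of the sets `S b` opposite to
those given by a node. -/
structure DecidedSkeleton (S : K → Set ℕ) (A : Set (Set ℕ)) where
  skel : Skeleton A
  node : K × (K → Bool)
  rank : K → List ℕ → Ordinal.{0}
  null : K → List ℕ → Set ℕ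
  thin : ∀ b < node.1, skel.ThinBy (side (S b) (!node.2 b)) (rank b) (null b)

namespace DecidedSkeleton

variable {S : K → Set ℕ} {A : Set (Set ℕ)}

/-- `q` extends `p`, keeping the witnesses. -/
def Extends (q p : DecidedSkeleton S A) : Prop :=
  q.skel.Sub p.skel ∧ NodeLE p.node q.node ∧ ∀ b < p.node.1, q.null b = p.null b

theorem Extends.refl (p : DecidedSkeleton S A) : p.Extends p :=
  ⟨Skeleton.Sub.refl _, NodeLE.refl _, fun _ _ => rfl⟩

theorem Extends.trans {p q r : DecidedSkeleton S A} (h : r.Extends q) (h' : q.Extends p) :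
    r.Extends p :=
  ⟨h.1.trans h'.1, h'.2.1.trans h.2.1, fun b hb =>
    (h.2.2 b (hb.trans_le h'.2.1.1)).trans (h'.2.2 b hb)⟩

/-- Every decided skeleton has two extensions with incompatible nodes. -/
theorem exists_split [WellFoundedLT K] [NoMaxOrder K] (hA : IsAD A) (hS : IsStronglySplitting S)
    (p : DecidedSkeleton S A) : ∃ q : Bool → DecidedSkeleton S A, (∀ c, (q c).Extends p) ∧
      ∃ b, ∀ c, b < (q c).node.1 ∧ (q c).node.2 b = c := by
  classical
  obtain ⟨b, hb, hmin⟩ := (wellFounded_lt (α := K)).has_min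
    {b | ∀ c, ¬ p.skel.Thin (side (S b) c)} (by
      obtain ⟨b, h1, h2⟩ := p.skel.exists_not_thin hA hS
      refine ⟨b, fun c => ?_⟩
      cases c
      · simpa using h2
      · simpa using h1)
  have hpb : p.node.1 ≤ b := by
    by_contra hlt
    exact hb _ ⟨_, _, p.thin b (not_le.1 hlt)⟩
  -- The immediate successor `b'` of `b` is the length of the new nodes, whose last decision is `c`
  -- at `b`.
  obtain ⟨b', hb', hmin'⟩ := (wellFounded_lt (α := K)).has_min (Ioi b) (exists_gt b)
  have hle : ∀ a, a < b' → a ≤ b := fun a ha => not_lt.1 fun h => hmin' a h ha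
  have hdec : ∀ a, ∃ (η : Bool) (r : List ℕ → Ordinal.{0}) (N : List ℕ → Set ℕ), a < b →
      p.skel.ThinBy (side (S a) (!η)) r N := by
    intro a
    by_cases ha : a < b
    · have : ¬ ∀ c, ¬ p.skel.Thin (side (S a) c) := fun h => hmin a h ha
      push Not at this
      obtain ⟨c, r, N, h⟩ := this
      exact ⟨!c, r, N, fun _ => by simpa using h⟩
    · exact ⟨true, fun _ => 0, fun _ => ∅, fun h => absurd h ha⟩
  choose η r N hη using hdec
  have hcol : ∀ c, ∃ (q : Skeleton A) (r : List ℕ → Ordinal.{0}) (N : List ℕ → Set ℕ),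
      q.Sub p.skel ∧ q.ThinBy (side (S b) (!c)) r N := by
    intro c
    rcases p.skel.thin_or_exists_sub (side (S b) c) with h | ⟨q, hq, hqc⟩
    · exact absurd h (hb c)
    · obtain ⟨r, N, h⟩ := Skeleton.thin_of_succ_subset_compl (p := q) (U := side (S b) (!c)) (by
        intro t ht
        rw [side_not, compl_compl]
        exact hqc t ht)
      exact ⟨q, r, N, hq, h⟩
  choose q r' N' hq hqc using hcol
  refine ⟨fun c =>
    { skel := q c
      node := (b', fun a => if a < p.node.1 then p.node.2 a else if a < b then η a else c)
      rank := fun a => if a < p.node.1 then p.rank a else if a < b then r a else r' c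
      null := fun a => if a < p.node.1 then p.null a else if a < b then N a else N' c
      thin := ?_ }, fun c => ⟨hq c, ⟨hpb.trans (le_of_lt hb'), fun a ha => ?_⟩, fun a ha => ?_⟩,
      b, fun c => ⟨hb', ?_⟩⟩
  · intro a ha
    by_cases h1 : a < p.node.1
    · simp only [h1, if_true]
      exact (p.thin a h1).mono (hq c)
    · by_cases h2 : a < b
      · simp only [h1, h2, if_true, if_false]
        exact (hη a h2).mono (hq c)
      · have : a = b := le_antisymm (hle a ha) (not_lt.1 h2)
        subst this
        simp only [h1, h2, if_false]
        exact hqc c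
  · simp [ha]
  · simp [ha]
  · simp [not_lt.2 hpb]

/-- Restriction to the part above a successor of a node. -/
def above (p : DecidedSkeleton S A) (t : List ℕ) (ht : t ∈ p.skel.nodes) (n : ℕ)
    (hn : n ∈ p.skel.succ t) : DecidedSkeleton S A where
  skel := p.skel.above t ht n hn
  node := p.node
  rank := p.rank
  null := p.null
  thin b hb := (p.thin b hb).mono (p.skel.above_sub t ht n hn)

theorem above_extends (p : DecidedSkeleton S A) (t : List ℕ) (ht : t ∈ p.skel.nodes) (n : ℕ)
    (hn : n ∈ p.skel.succ t) : (p.above t ht n hn).Extends p :=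
  ⟨p.skel.above_sub t ht n hn, NodeLE.refl _, fun _ _ => rfl⟩

end DecidedSkeleton

variable {S : K → Set ℕ} {I : Set (Set ℕ)} {G : Set (Set ℕ × (K × (K → Bool)))}

/-- Every tree which is positively branching with respect to a good family of size less than the
continuum has a branch with positive range. -/
theorem IsGood.exists_positive_branch (hG : IsGood S I G) [WellFoundedLT K] [NoMaxOrder K]
    [Nonempty K] (hK : ∀ b : K, Cardinal.mk (Iio b) < splittingNumber)
    (hsa : splittingNumber ≤ almostDisjointnessNumber) (hS : IsStronglySplitting S)
    (hcard : Cardinal.mk G < Cardinal.continuum) {T : Descriptive.tree ℕ}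
    (hT : IsBranching (positive (generatedIdeal (Prod.fst '' G))) T) :
    ∃ f ∈ branches T, range f ∉ generatedIdeal (Prod.fst '' G) := by
  classical
  set A := Prod.fst '' G with hAdef
  have hA : IsAD A := hG.isAD
  choose c hcext hcsplit using DecidedSkeleton.exists_split (S := S) hA hS
  choose t ht using fun (a : DecidedSkeleton S A) (b : Bool) => (c a b).skel.nonempty
  -- Successors of `t a b` almost disjoint from all the fewer than `𝔰` sets that matter at this
  -- stage: the small sets at `t a b` and the members of `G` with nodes below.
  choose Z hZsub hZinf hZG hZN using fun (a : DecidedSkeleton S A) (b : Bool) =>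
    hG.exists_almostDisjoint aleph0_le_splittingNumber hK hsa (c a b).node
      (N := fun β => (c a b).null β (t a b)) (fun β hβ => ((c a b).thin β hβ).2.1 _ (ht a b))
      ((c a b).skel.pos _ (ht a b))
  choose n hnZ hn using fun (a : DecidedSkeleton S A) (b : Bool) (j : ℕ) => (hZinf a b).exists_gt j
  let child : DecidedSkeleton S A → Bool → ℕ → DecidedSkeleton S A := fun a b j =>
    (c a b).above (t a b) (ht a b) (n a b j) (hZsub a b (hnZ a b j))
  have hchild : ∀ a b j, (child a b j).Extends (c a b) := fun a b j =>
    DecidedSkeleton.above_extends _ _ _ _ _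
  obtain ⟨b₀, -, hb₀⟩ := (wellFounded_lt (α := K)).has_min univ univ_nonempty
  let start : DecidedSkeleton S A :=
    { skel :=
        { nodes := {t | t ∈ T}
          succ := successors T
          nonempty := ⟨[], hT.1⟩
          pos := hT.2
          ext := fun t _ n hn => ⟨t ++ [n], hn, List.prefix_rfl⟩ }
      node := (b₀, fun _ => true)
      rank := fun _ _ => 0
      null := fun _ _ => ∅
      thin := fun b hb => absurd hb (hb₀ b trivial) }
  let st : List (Bool × ℕ) → DecidedSkeleton S A :=
    fun w => w.foldr (fun e a => child a e.1 e.2) start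
  -- the sets to be avoided at a node
  let bad : DecidedSkeleton S A → Bool → K ⊕ (Set ℕ × (K × (K → Bool))) → Set ℕ := fun a b =>
    Sum.elim (fun β => (c a b).null β (t a b)) Prod.fst
  let active : DecidedSkeleton S A → Bool → Set (K ⊕ (Set ℕ × (K × (K → Bool)))) := fun a b =>
    Sum.inl '' Iio (c a b).node.1 ∪ Sum.inr '' {y ∈ G | NodeLE y.2 (c a b).node}
  have hactive : ∀ a b, Cardinal.mk (active a b) < splittingNumber := fun a b =>
    lt_of_le_of_lt (Cardinal.mk_union_le _ _) (Cardinal.add_lt_of_lt aleph0_le_splittingNumber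
      (lt_of_le_of_lt Cardinal.mk_image_le (hK _))
      (lt_of_le_of_lt Cardinal.mk_image_le (hG.mk_nodeLE_lt hK _)))
  have hbound : ∀ a b i, ∃ h, i ∈ active a b → ∀ m ∈ Z a b ∩ bad a b i, m ≤ h := by
    intro a b i
    by_cases hi : i ∈ active a b
    · have hfin : (Z a b ∩ bad a b i).Finite := by
        rcases hi with ⟨β, hβ, rfl⟩ | ⟨y, hy, rfl⟩
        · exact hZN a b β hβ
        · exact hZG a b y hy.1 hy.2
      obtain ⟨h, hh⟩ := hfin.bddAbove
      exact ⟨h, fun _ m hm => hh hm⟩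
    · exact ⟨0, fun h => absurd h hi⟩
  choose h hh using hbound
  obtain ⟨q, hq⟩ := exists_surjective_nat (List (Bool × ℕ) × Bool)
  -- The sequence `g` must not depend on the path `x`, so the bound is uniform over the finitely
  -- many histories with length and entries at most `l + 1`.
  have hH : ∀ (m : ℕ) (F : Finset (active (st (q m).1) (q m).2)) (l : ℕ), ∃ H, ∀ w : List (Bool × ℕ),
      w.length ≤ l + 1 → (∀ e ∈ w, e.2 ≤ l + 1) → ∀ b, ∀ i ∈ F, h (st w) b i ≤ H := by
    intro m F l
    have hfin := ((finite_short_lists (l + 1)).prod ((finite_univ (α := Bool)).prod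
      F.finite_toSet)).image fun x => h (st x.1) x.2.1 x.2.2
    obtain ⟨H, hH⟩ := hfin.bddAbove
    exact ⟨H, fun w hw hw' b i hi => hH ⟨(w, b, i), ⟨⟨hw, hw'⟩, trivial, hi⟩, rfl⟩⟩
  choose H hH using hH
  obtain ⟨g, hg, hgH⟩ := exists_strictMono_escaping
    (fun m => mk_finset_lt aleph0_le_splittingNumber (hactive (st (q m).1) (q m).2)) H
  let w : (ℕ → Bool) → ℕ → List (Bool × ℕ) := fun x k =>
    Nat.rec [] (fun k w => (x k, g k) :: w) k
  have hwlen : ∀ x k, (w x k).length = k := by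
    intro x k
    induction k with
    | zero => rfl
    | succ k ih => exact congrArg Nat.succ ih
  have hwle : ∀ x k, ∀ e ∈ w x (k + 1), e.2 ≤ g k := by
    intro x k
    induction k with
    | zero =>
      intro e he
      have : e = (x 0, g 0) := by simpa [w] using he
      simp [this]
    | succ k ih =>
      intro e he
      rcases List.mem_cons.1 (show e ∈ (x (k + 1), g (k + 1)) :: w x (k + 1) from he) with rfl | he
      · exact le_rfl
      · exact (ih e he).trans (hg.monotone (Nat.le_succ k))
  let a : (ℕ → Bool) → ℕ → DecidedSkeleton S A := fun x k => st (w x k)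
  have ha : ∀ x k, a x (k + 1) = child (a x k) (x k) (g k) := fun _ _ => rfl
  have hcc : ∀ x k l, k ≤ l → (c (a x l) (x l)).Extends (c (a x k) (x k)) := by
    intro x k l hkl
    induction l, hkl using Nat.le_induction with
    | base => exact DecidedSkeleton.Extends.refl _
    | succ l _ ih =>
      refine (hcext (a x (l + 1)) (x (l + 1))).trans (DecidedSkeleton.Extends.trans ?_ ih)
      rw [ha]
      exact hchild _ _ _
  -- a sequence `x` whose nodes are not all below a node of `G`
  obtain ⟨x, hx⟩ : ∃ x : ℕ → Bool, ∀ y ∈ G, ∃ k, ¬ NodeLE (c (a x k) (x k)).node y.2 := by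
    by_contra hcon
    push Not at hcon
    choose Φ hΦG hΦ using hcon
    have hinj : Function.Injective fun x => (⟨Φ x, hΦG x⟩ : G) := by
      intro x y hxy
      replace hxy : Φ x = Φ y := congrArg Subtype.val hxy
      by_contra hne
      have hex : ∃ k, x k ≠ y k := Function.ne_iff.1 hne
      have hlt : ∀ i < Nat.find hex, x i = y i := fun i hi => not_not.1 (Nat.find_min hex hi)
      have hw : ∀ i ≤ Nat.find hex, w x i = w y i := by
        intro i hi
        induction i with
        | zero => rfl
        | succ i ih =>
          change (x i, g i) :: w x i = (y i, g i) :: w y i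
          rw [ih (by omega), hlt i (by omega)]
      have hax : a x (Nat.find hex) = a y (Nat.find hex) := congrArg st (hw _ le_rfl)
      obtain ⟨β, hβ⟩ := hcsplit (a x (Nat.find hex))
      have h1 := (hΦ x (Nat.find hex)).2 β (hβ _).1
      have h2 := (hΦ y (Nat.find hex)).2 β (by rw [← hax]; exact (hβ _).1)
      rw [(hβ _).2] at h1
      rw [← hax, (hβ _).2] at h2
      refine Nat.find_spec hex ?_
      rw [h1, h2, hxy]
    have := Cardinal.mk_le_of_injective hinj
    rw [show Cardinal.mk (ℕ → Bool) = Cardinal.continuum by simp] at this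
    exact absurd this (not_le.2 hcard)
  let tt : ℕ → List ℕ := fun k => t (a x k) (x k)
  let nn : ℕ → ℕ := fun k => n (a x k) (x k) (g k)
  have htt : ∀ j k, j ≤ k → tt k ∈ (c (a x j) (x j)).skel.nodes := fun j k hjk =>
    (hcc x j k hjk).1.1 (ht _ _)
  have hnnZ : ∀ k, nn k ∈ Z (a x k) (x k) := fun k => hnZ _ _ _
  have hnn : ∀ j k, j ≤ k → nn k ∈ (c (a x j) (x j)).skel.succ (tt k) := fun j k hjk =>
    (hcc x j k hjk).1.2 _ (ht _ _) (hZsub _ _ (hnnZ k))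
  have htn : ∀ k, tt k ++ [nn k] <+: tt (k + 1) := by
    intro k
    have h1 : tt (k + 1) ∈ (a x (k + 1)).skel.nodes := (hcext _ _).1.1 (ht _ _)
    rw [ha] at h1
    exact h1.2
  have hnlt : ∀ k, k < nn k := fun k => hg.le_apply.trans_lt (hn _ _ _)
  have hstartext : ∀ u, (st u).Extends start := by
    intro u
    induction u with
    | nil => exact DecidedSkeleton.Extends.refl _
    | cons e u ih => exact (hchild (st u) e.1 e.2).trans ((hcext _ _).trans ih)
  have httT : ∀ k, tt k ∈ T := fun k => (hstartext (w x k)).1.1 ((hcext _ _).1.1 (ht _ _))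
  have hevn : ∀ {B : Set ℕ}, B.Finite → ∀ᶠ k in atTop, nn k ∉ B := by
    intro B hB
    obtain ⟨m, hm⟩ := hB.bddAbove
    filter_upwards [eventually_ge_atTop m] with k hk hkB
    have := hm hkB
    have := hnlt k
    omega
  obtain ⟨f, hf, hfn⟩ := exists_branch_of_chain httT htn
  refine ⟨f, hf, ?_⟩
  rintro ⟨F, hF, hFA, hfF⟩
  -- If the nodes along `x` pass the node of a member `y`, then `y` itself becomes active. Otherwise
  -- the two disagree at some `β`; then `y` is almost contained in the side for which the skeleton
  -- is thin, and the branch eventually meets it only inside the small sets for `β`.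
  have hidx : ∀ B ∈ F, ∃ i, (∀ᶠ k in atTop, i ∈ active (a x k) (x k)) ∧
      ∀ᶠ k in atTop, nn k ∉ bad (a x k) (x k) i → nn k ∉ B := by
    intro B hB
    obtain ⟨y, hy, rfl⟩ := hFA hB
    obtain ⟨k₀, hk₀⟩ := hx y hy
    rcases nodeLE_or (c (a x k₀) (x k₀)).node y.2 with hle | hle | ⟨β, hβ, hβy, hne⟩
    · exact absurd hle hk₀
    · refine ⟨Sum.inr y, ?_, Eventually.of_forall fun k hk => hk⟩
      filter_upwards [eventually_ge_atTop k₀] with k hk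
      exact Or.inr ⟨y, ⟨hy, hle.trans (hcc x k₀ k hk).2.1⟩, rfl⟩
    · refine ⟨Sum.inl β, ?_, ?_⟩
      · filter_upwards [eventually_ge_atTop k₀] with k hk
        exact Or.inl ⟨β, hβ.trans_le (hcc x k₀ k hk).2.1.1, rfl⟩
      · have e1 := ((c (a x k₀) (x k₀)).thin β hβ).eventually_mem (htt k₀) (hnn k₀) htn
        filter_upwards [eventually_ge_atTop k₀, e1, hevn (hG.almost y hy β hβy)]
          with k hk h1 h2 hbad hyk
        have h3 : y.2.2 β = !(c (a x k₀) (x k₀)).node.2 β := by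
          revert hne
          cases y.2.2 β <;> cases (c (a x k₀) (x k₀)).node.2 β <;> simp
        rw [h3] at h2
        have h4 := h1 (by_contra fun h => h2 ⟨hyk, h⟩)
        -- Extensions keep the small sets, so those of stage `k₀` are the ones avoided at stage `k`.
        rw [← (hcc x k₀ k hk).2.2 β hβ] at h4
        exact hbad h4
  choose! i hiact hibad using hidx
  have e1 : ∀ᶠ k in atTop, ∀ B ∈ F, i B ∈ active (a x k) (x k) :=
    (eventually_all_finite hF).2 hiact
  have e2 : ∀ᶠ k in atTop, ∀ B ∈ F, nn k ∉ bad (a x k) (x k) (i B) → nn k ∉ B :=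
    (eventually_all_finite hF).2 hibad
  obtain ⟨k₁, hk₁⟩ := eventually_atTop.1 (e1.and (e2.and (hevn hfF)))
  obtain ⟨m, hm⟩ := hq (w x k₁, x k₁)
  have hact : ∀ B ∈ F, i B ∈ active (st (q m).1) (q m).2 := by
    rw [hm]
    exact (hk₁ k₁ le_rfl).1
  -- All indices needed for `F` are active at the single stage `k₁`, one of the countably many to
  -- which the choice of `g` applies.
  let E : Finset (active (st (q m).1) (q m).2) :=
    hF.toFinset.attach.image fun B => ⟨i B.1, hact B.1 (hF.mem_toFinset.1 B.2)⟩
  obtain ⟨k, hk, hkg⟩ := frequently_atTop.1 (hgH m E) k₁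
  obtain ⟨h1, h2, h3⟩ := hk₁ (k + 1) (by omega)
  refine h3 ⟨hfn (k + 1), ?_⟩
  rintro ⟨B, hB, hBn⟩
  refine h2 B hB (fun hbad => ?_) hBn
  have h4 := hh (a x (k + 1)) (x (k + 1)) (i B) (h1 B hB) _ ⟨hnnZ (k + 1), hbad⟩
  have hkk : k ≤ g k := hg.le_apply
  have h5 := hH m E (g k) (w x (k + 1)) ((hwlen x (k + 1)).trans_le (by omega))
    (fun e he => (hwle x k e he).trans (Nat.le_succ _)) (x (k + 1)) ⟨i B, hact B hB⟩
    (Finset.mem_image.2 ⟨⟨B, hF.mem_toFinset.2 hB⟩, Finset.mem_attach _ _, rfl⟩)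
  have h6 : g (k + 1) < nn (k + 1) := hn _ _ _
  have h7 : h (a x (k + 1)) (x (k + 1)) (i B) ≤ H m E (g k) := h5
  omega

end

/-! ### The recursion and the corollary -/

section

variable {K : Type} [LinearOrder K] {S : K → Set ℕ}

/-- Goodness only constrains pairs of members, so it passes to unions of chains. -/
theorem isGood_of_pairs {I : Set (Set ℕ)} {G : Set (Set ℕ × (K × (K → Bool)))}
    (h : ∀ x ∈ G, ∀ y ∈ G, ∃ G', IsGood S I G' ∧ x ∈ G' ∧ y ∈ G') : IsGood S I G := by
  refine ⟨fun x hx => ?_, fun x hx => ?_, fun x hx => ?_, fun x hx y hy => ?_, fun x hx y hy => ?_⟩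
  · obtain ⟨G', hG', hx', -⟩ := h x hx x hx
    exact hG'.infinite x hx'
  · obtain ⟨G', hG', hx', -⟩ := h x hx x hx
    exact hG'.mem x hx'
  · obtain ⟨G', hG', hx', -⟩ := h x hx x hx
    exact hG'.almost x hx'
  · obtain ⟨G', hG', hx', hy'⟩ := h x hx y hy
    exact hG'.ad x hx' y hy'
  · obtain ⟨G', hG', hx', hy'⟩ := h x hx y hy
    exact hG'.nodes x hx' y hy'

/-- A good family of size less than the continuum can be extended by infinitely many subsets of the
range of a branch of a given positively branching tree. -/
theorem IsGood.exists_branch_extension {J : Order.Ideal (Set ℕ)}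
    {G : Set (Set ℕ × (K × (K → Bool)))} (hG : IsGood S J G) (hJ : IsTall J)
    [WellFoundedLT K] [NoMaxOrder K] [Nonempty K]
    (hK : ∀ b : K, Cardinal.mk (Iio b) < splittingNumber)
    (hsa : splittingNumber ≤ almostDisjointnessNumber) (hS : IsStronglySplitting S)
    (hcard : Cardinal.mk G < Cardinal.continuum) {T : Descriptive.tree ℕ}
    (hT : IsBranching (positive (generatedIdeal (Prod.fst '' G))) T) :
    ∃ N : Set (Set ℕ × (K × (K → Bool))), (N.Countable ∧ IsGood S J (G ∪ N)) ∧ N.Infinite ∧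
      ∃ f ∈ branches T, ∀ y ∈ N, y.1 ⊆ range f := by
  obtain ⟨f, hf, hfG⟩ := hG.exists_positive_branch hK hsa hS hcard hT
  obtain ⟨N, h1, h2, h3, h4⟩ := hG.exists_extension hJ aleph0_le_splittingNumber hK hsa hS hcard hfG
  exact ⟨N, ⟨h1, h3⟩, h2, f, hf, h4⟩

end

theorem mk_Iio_ord_toType_lt {κ : Cardinal.{0}} (b : κ.ord.ToType) :
    Cardinal.mk (Iio b) < κ := by
  simpa using Cardinal.mk_Iio_lt b (by simp)

theorem mk_tree_le_continuum : Cardinal.mk (Descriptive.tree ℕ) ≤ Cardinal.continuum.{0} := by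
  refine (Cardinal.mk_subtype_le _).trans ?_
  simp

/-- There is a good family such that every positively branching tree has a branch whose range
contains infinitely many members of the family. -/
theorem exists_isGood_saturated {K : Type} [LinearOrder K] {S : K → Set ℕ}
    {J : Order.Ideal (Set ℕ)} (hJ : IsTall J) [WellFoundedLT K] [NoMaxOrder K] [Nonempty K]
    (hK : ∀ b : K, Cardinal.mk (Iio b) < splittingNumber)
    (hsa : splittingNumber ≤ almostDisjointnessNumber) (hS : IsStronglySplitting S) :
    ∃ G : Set (Set ℕ × (K × (K → Bool))), IsGood S J G ∧ (G.Nonempty → G.Infinite) ∧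
      ∀ T, IsBranching (positive (generatedIdeal (Prod.fst '' G))) T →
        ∃ f ∈ branches T, {y ∈ G | y.1 ⊆ range f}.Infinite := by
  classical
  have hstep : ∀ (G : Set (Set ℕ × (K × (K → Bool)))) (T : Descriptive.tree ℕ),
      ∃ N : Set (Set ℕ × (K × (K → Bool))), IsGood S J G → Cardinal.mk G < Cardinal.continuum →
        (N.Countable ∧ IsGood S J (G ∪ N) ∧ (N.Nonempty → N.Infinite)) ∧
        (IsBranching (positive (generatedIdeal (Prod.fst '' G))) T → N.Infinite ∧
          ∃ f ∈ branches T, ∀ y ∈ N, y.1 ⊆ range f) := by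
    intro G T
    by_cases h : IsGood S J G ∧ Cardinal.mk G < Cardinal.continuum ∧
        IsBranching (positive (generatedIdeal (Prod.fst '' G))) T
    · obtain ⟨N, h1, h2⟩ := h.1.exists_branch_extension hJ hK hsa hS h.2.1 h.2.2
      exact ⟨N, fun _ _ => ⟨⟨h1.1, h1.2, fun _ => h2.1⟩, fun _ => h2⟩⟩
    · refine ⟨∅, fun h1 h2 => ⟨⟨countable_empty, by simpa using h1, by simp⟩, fun h3 => ?_⟩⟩
      exact absurd ⟨h1, h2, h3⟩ h
  choose step hstep using hstep
  let C := Cardinal.continuum.{0}.ord.ToType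
  have hC : Cardinal.mk (Descriptive.tree ℕ) ≤ Cardinal.mk C := by
    rw [Cardinal.mk_ord_toType]
    exact mk_tree_le_continuum
  obtain ⟨emb⟩ := Cardinal.le_def _ _ |>.1 hC
  have hsurj : Function.Surjective (Function.invFun emb) := Function.invFun_surjective emb.injective
  let e : C → Descriptive.tree ℕ := Function.invFun emb
  let N : C → Set (Set ℕ × (K × (K → Bool))) :=
    WellFoundedLT.fix fun α ih => step (⋃ β : Iio α, ih β.1 β.2) (e α)
  have hN : ∀ α, N α = step (⋃ β : Iio α, N β) (e α) := fun α => WellFoundedLT.fix_eq _ α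
  let G : C → Set (Set ℕ × (K × (K → Bool))) := fun α => ⋃ β : Iio α, N β
  have hmem : ∀ β α x, x ∈ N β → β ≤ α → x ∈ G α ∪ N α := by
    intro β α x hx hβ
    rcases hβ.lt_or_eq with h | rfl
    · exact Or.inl (mem_iUnion.2 ⟨⟨β, h⟩, hx⟩)
    · exact Or.inr hx
  have hpairs : ∀ {D : Set C}, (∀ α ∈ D, IsGood S J (G α ∪ N α)) →
      IsGood S J (⋃ β : D, N β) := by
    intro D hD
    refine isGood_of_pairs fun x hx y hy => ?_
    obtain ⟨⟨β, hβ⟩, hx⟩ := mem_iUnion.1 hx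
    obtain ⟨⟨γ, hγ⟩, hy⟩ := mem_iUnion.1 hy
    rcases le_total β γ with h | h
    · exact ⟨_, hD γ hγ, hmem β γ x hx h, hmem γ γ y hy le_rfl⟩
    · exact ⟨_, hD β hβ, hmem β β x hx le_rfl, hmem γ β y hy h⟩
  have hall : ∀ α, IsGood S J (G α) ∧ Cardinal.mk (G α) < Cardinal.continuum ∧ (N α).Countable ∧
      IsGood S J (G α ∪ N α) ∧ ((N α).Nonempty → (N α).Infinite) := by
    intro α
    induction α using WellFoundedLT.induction with
    | ind α ih =>
      have h1 : IsGood S J (G α) := hpairs fun β hβ => (ih β hβ).2.2.2.1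
      have h2 : Cardinal.mk (G α) < Cardinal.continuum := by
        refine lt_of_le_of_lt (Cardinal.mk_iUnion_le _) ?_
        refine Cardinal.mul_lt_of_lt Cardinal.aleph0_le_continuum
          (mk_Iio_ord_toType_lt α) ?_
        refine lt_of_le_of_lt (ciSup_le' fun β => ?_) Cardinal.aleph0_lt_continuum
        exact Cardinal.mk_le_aleph0_iff.2 (ih β.1 β.2).2.2.1.to_subtype
      have h3 := (hstep (G α) (e α) h1 h2).1
      exact ⟨h1, h2, by rwa [hN]⟩
  refine ⟨⋃ β : (univ : Set C), N β, hpairs fun α _ => (hall α).2.2.2.1, ?_, fun T hT => ?_⟩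
  · rintro ⟨x, hx⟩
    obtain ⟨β, hβ⟩ := mem_iUnion.1 hx
    exact ((hall β.1).2.2.2.2 ⟨x, hβ⟩).mono (subset_iUnion_of_subset β subset_rfl)
  obtain ⟨α, rfl⟩ := hsurj T
  have hsub : G α ⊆ ⋃ β : (univ : Set C), N β :=
    iUnion_subset fun β => subset_iUnion_of_subset ⟨β.1, trivial⟩ subset_rfl
  -- Sets positive for the final family are positive for every earlier one, so `T` was handled at
  -- its stage.
  have hT' : IsBranching (positive (generatedIdeal (Prod.fst '' G α))) (e α) :=
    ⟨hT.1, fun s hs h => hT.2 s hs (generatedIdeal_mono_family (image_mono hsub) h)⟩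
  obtain ⟨hinf, f, hf, hNf⟩ := (hstep (G α) (e α) (hall α).1 (hall α).2.1).2 hT'
  rw [← hN] at hinf hNf
  exact ⟨f, hf, hinf.mono fun y hy => ⟨mem_iUnion.2 ⟨⟨α, trivial⟩, hy⟩, hNf y hy⟩⟩

/-- The tree of all finite sequences with entries in `X`. -/
def fullTree (X : Set ℕ) : Descriptive.tree ℕ :=
  ⟨{s | ∀ n ∈ s, n ∈ X}, fun _ _ h n hn => h n (List.mem_append_left _ hn)⟩

theorem mem_fullTree {X : Set ℕ} {s : List ℕ} : s ∈ fullTree X ↔ ∀ n ∈ s, n ∈ X := Iff.rfl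

theorem isBranching_fullTree {𝒳 : Set (Set ℕ)} {X : Set ℕ} (hX : X ∈ 𝒳) :
    IsBranching 𝒳 (fullTree X) := by
  refine ⟨mem_fullTree.2 (by simp), fun s hs => ?_⟩
  convert hX
  ext n
  refine ⟨fun h => mem_fullTree.1 h n (by simp), fun h => mem_fullTree.2 fun m hm => ?_⟩
  rcases List.mem_append.1 hm with hm | hm
  · exact mem_fullTree.1 hs m hm
  · rw [List.mem_singleton.1 hm]
    exact h

theorem range_subset_of_mem_branches_fullTree {X : Set ℕ} {f : ℕ → ℕ}
    (hf : f ∈ branches (fullTree X)) : range f ⊆ X := by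
  rintro _ ⟨k, rfl⟩
  refine mem_fullTree.1 (hf (k + 1)) _ ?_
  exact List.mem_map.2 ⟨k, by simp, rfl⟩

end PlusRamsey

theorem corollary25
    (h : PlusRamsey.splittingNumber ≤ PlusRamsey.almostDisjointnessNumber)
    (I : Order.Ideal (Set ℕ)) (hI : PlusRamsey.IsTall I) :
    ∃ A : Set (Set ℕ),
      PlusRamsey.IsMAD A ∧ PlusRamsey.IsPlusRamsey A ∧ A ⊆ (I : Set (Set ℕ)) := by
  open PlusRamsey Set in
  have hs := aleph0_le_splittingNumber
  have : NoMaxOrder splittingNumber.ord.ToType := Cardinal.noMaxOrder hs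
  have : Nonempty splittingNumber.ord.ToType := by
    rw [← Cardinal.mk_ne_zero_iff, Cardinal.mk_ord_toType]
    exact (Cardinal.aleph0_pos.trans_le hs).ne'
  obtain ⟨S, hS⟩ := exists_isStronglySplitting (Cardinal.mk_ord_toType splittingNumber)
  obtain ⟨G, hG, hGinf, hsat⟩ :=
    exists_isGood_saturated hI (fun b => mk_Iio_ord_toType_lt b) h hS
  have himg : ∀ {D : Set _}, D ⊆ G → D.Infinite → (Prod.fst '' D).Infinite := fun hD hinf =>
    hinf.image (hG.injOn_fst.mono hD)
  have hpos : ∀ X, X.Infinite → (∀ B ∈ Prod.fst '' G, (X ∩ B).Finite) →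
      X ∈ positive (generatedIdeal (Prod.fst '' G)) := by
    rintro X hX hXG ⟨F, hF, hFG, hXF⟩
    obtain ⟨B, hB, hBi⟩ := exists_infinite_inter_of_cover hX hF hXF
    exact hBi (hXG B (hFG hB))
  refine ⟨Prod.fst '' G, ⟨?_, hG.isAD, fun D hD hGD => ?_⟩, fun T hT => ?_, ?_⟩
  · refine himg subset_rfl (hGinf ?_)
    by_contra hempty
    rw [not_nonempty_iff_eq_empty] at hempty
    -- For an empty family `univ` would be positive, and its full tree would provide members.
    obtain ⟨f, -, hf⟩ := hsat _ (isBranching_fullTree (hpos univ infinite_univ (by simp [hempty])))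
    obtain ⟨y, hy, -⟩ := hf.nonempty
    rw [hempty] at hy
    exact hy
  · intro X hX
    by_contra hXG
    have hfin : ∀ B ∈ Prod.fst '' G, (X ∩ B).Finite := fun B hB =>
      hD.2 hX (hGD hB) fun h => hXG (h ▸ hB)
    -- A set `X` almost disjoint from all members is positive, so the full tree over `X` has a
    -- branch whose range, a subset of `X`, contains a member.
    obtain ⟨f, hf, hinf⟩ := hsat _ (isBranching_fullTree (hpos X (hD.1 X hX) hfin))
    obtain ⟨y, hy, hyf⟩ := hinf.nonempty
    refine hG.infinite y hy ((hfin y.1 ⟨y, hy, rfl⟩).subset fun n hn => ⟨?_, hn⟩)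
    exact range_subset_of_mem_branches_fullTree hf (hyf hn)
  · obtain ⟨f, hf, hinf⟩ := hsat T hT
    refine ⟨f, hf, notMem_generatedIdeal_of_infinite_meets hG.isAD ?_⟩
    refine (himg (fun y hy => hy.1) hinf).mono ?_
    rintro _ ⟨y, ⟨hy, hyf⟩, rfl⟩
    refine ⟨⟨y, hy, rfl⟩, ?_⟩
    rw [inter_eq_self_of_subset_right hyf]
    exact hG.infinite y hy
  · rintro _ ⟨y, hy, rfl⟩
    exact hG.mem y hy
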